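/- Let $\mathbf V$ be an infinite set of variables, and let $\mathbf N$, $\mathbf I$, $\mathbf P$ be sets of names, agents, and predicate symbols, each predicate symbol with a fixed finite arity. Terms are $t::=x\mid a$ with $x\in\mathbf V$, $a\in\mathbf N$. The language $\mathbf{DELAS}$ is $$\varphi::=t\approx t\mid P\vec t\mid(\varphi\land\varphi)\mid\neg\varphi\mid\mathsf K_i\varphi\mid[x:=t]\varphi\mid[\mathcal E,e]\varphi ,$$ where (by mutual induction) $\mathcal E=\langle E,\rightarrowtail,Pre\rangle$ is an event model: $E$ is a finite non-empty set, $\rightarrowtail_i\subseteq E\times E$ for each $i\in\mathbf I$, $Pre:E\to\mathbf{DELAS}$, and $e\in E$. Formulas $t\approx t'$ and $P\vec t$ are atomic; $\top,\to,\leftrightarrow$ are the usual abbreviations, $\langle x:=t\rangle\varphi$ is $\neg[x:=t]\neg\varphi$, and $\vec t\approx\vec t'$ is the conjunction of the pointwise equations. The operator $[x:=t]$ binds $x$ in its scope (not in $t$); $[\mathcal E,e]$ binds nothing, and the free variables of $[\mathcal E,e]\varphi$ are those of $\varphi$ and of all preconditions of $\mathcal E$. $\varphi[y/x]$ is the result of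 replacing all free occurrences of $x$ in $\varphi$ (also in preconditions) by $y$; it is admissible if all these new occurrences of $y$ are free in $\varphi[y/x]$. A (Kripke) model $\mathcal M=\langle W,D,R,\rho,\eta\rangle$ has non-empty sets $W$ (worlds) and $D$ (objects), relations $R_i\subseteq W\times W$ for $i\in\mathbf I$, $\rho(P,w)\subseteq D^n$ for each $n$-ary $P$ and world $w$, and $\eta(a,w)\in D$ for each name $a$ and world $w$. It is epistemic if all $R_i$ are equivalence relations. For $\sigma:\mathbf V\to D$ put $\sigma_w(x)=\sigma(x)$ and $\sigma_w(a)=\eta(a,w)$. Truth is defined as usual for atomic formulas and Boolean connectives, and by - $\mathcal M,w,\sigma\vDash\mathsf K_i\varphi$ iff $\mathcal M,v,\sigma\vDash\varphi$ for all $v$ with $wR_iv$; - $\mathcal M,w,\sigma\vDash[x:=t]\varphi$ iff $\mathcal M,w,\sigma[x\mapsto\sigma_w(t)]\vDash\varphi$; - $\mathcal M,w,\sigma\vDash[\mathcal E,e]\varphi$ iff $\mathcal M,w,\sigma\vDash Pre(e)$ implies $(\mathcal M\otimes\mathcal E)^\sigma,(w,e),\sigma\vDash\varphi$, where $(\mathcal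 M\otimes\mathcal E)^\sigma$ has worlds $\{(v,f)\mid\mathcal M,v,\sigma\vDash Pre(f)\}$, domain $D$, relations $(v,f)R'_i(v',f')$ iff $vR_iv'$ and $f\rightarrowtail_if'$, and the interpretations $\rho'(P,(v,f))=\rho(P,v)$ and $\eta'(a,(v,f))=\eta(a,v)$. The composition $\mathcal E\circ\mathcal E'$ has events $E\times E'$, relations $(e,e')\rightarrowtail''_i(f,f')$ iff $e\rightarrowtail_if$ and $e'\rightarrowtail'_if'$, and $Pre''(e,e')=Pre(e)\land[\mathcal E,e]Pre'(e')$. The system $\mathsf{SDELAS}$ has the following axiom schemas, over all formulas of $\mathbf{DELAS}$: all instances of propositional tautologies; - $\mathsf K_i(\varphi\to\psi)\to(\mathsf K_i\varphi\to\mathsf K_i\psi)$; - $t\approx t$; $\ t\approx t'\leftrightarrow t'\approx t$; $\ t\approx t'\land t'\approx t''\to t\approx t''$; - $t\approx t'\to([x:=t]\varphi\leftrightarrow[x:=t']\varphi)$; $\ \vec t\approx\vec t'\to(P\vec t\leftrightarrow P\vec t')$; - $x\approx y\to\mathsf K_i\,x\approx y$; $\ x\not\approx y\to\mathsf K_i\,x\not\approx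 y$; - $[x:=t](\varphi\to\psi)\to([x:=t]\varphi\to[x:=t]\psi)$; $\ \langle x:=t\rangle\varphi\to[x:=t]\varphi$; $\ \langle x:=t\rangle\top$; $\ [x:=t]\,x\approx t$; - $\varphi[y/x]\to[x:=y]\varphi$, if $\varphi[y/x]$ is admissible; the reduction axioms - UATOM: $[\mathcal E,e]p\leftrightarrow(Pre(e)\to p)$, for atomic $p$; - UNEG: $[\mathcal E,e]\neg\varphi\leftrightarrow(Pre(e)\to\neg[\mathcal E,e]\varphi)$; - UCON: $[\mathcal E,e](\varphi\land\psi)\leftrightarrow([\mathcal E,e]\varphi\land[\mathcal E,e]\psi)$; - UK: $[\mathcal E,e]\mathsf K_i\varphi\leftrightarrow(Pre(e)\to\bigwedge_{e\rightarrowtail_if}\mathsf K_i[\mathcal E,f]\varphi)$; - UCOM: $[\mathcal E,e][\mathcal E',e']\varphi\leftrightarrow[\mathcal E\circ\mathcal E',(e,e')]\varphi$; - UASSI: $[\mathcal E,e][x:=t]\varphi\leftrightarrow[z:=x][x:=t][\mathcal E',e]\varphi$, where $z$ does not occur in $\varphi$, in $t$, or in $Pre_{\mathcal E}(f)$ for any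 $f\in\mathcal E$, and $\mathcal E'$ has the same events and relations as $\mathcal E$ and $Pre_{\mathcal E'}(f)=Pre_{\mathcal E}(f)[z/x]$ for every $f$; and the rules: from $\varphi$ infer $\mathsf K_i\varphi$; from $\varphi$ and $\varphi\to\psi$ infer $\psi$; from $\varphi\to\psi$ infer $\varphi\to[x:=t]\psi$ if $x$ is not free in $\varphi$. The system $\mathsf{SDELAS5}$ has in addition the axioms $\mathsf K_i\varphi\to\varphi$, $\ \mathsf K_i\varphi\to\mathsf K_i\mathsf K_i\varphi$, and $\neg\mathsf K_i\varphi\to\mathsf K_i\neg\mathsf K_i\varphi$. **Theorem.** $\mathsf{SDELAS}$ is complete over arbitrary models: every $\varphi\in\mathbf{DELAS}$ that is true at all worlds of all models under all assignments is a theorem of $\mathsf{SDELAS}$. $\mathsf{SDELAS5}$ is complete over epistemic models: every $\varphi\in\mathbf{DELAS}$ that is true at all worlds of all epistemic models under all assignments is a theorem of $\mathsf{SDELAS5}$. -/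

import Mathlib

universe u

namespace DELAS

/-- The non-logical vocabulary: variables, (non-rigid) names, agents, and predicate symbols with
their arities. -/
structure Signature where
  Var : Type u
  Name : Type u
  Agent : Type u
  Pred : Type u
  arity : Pred → ℕ

/-- Terms: variables and names. -/
inductive Term (S : Signature.{u}) : Type u where
  | var (x : S.Var) : Term S
  | name (a : S.Name) : Term S

/-- The events of an event model and the accessibility relation of each agent on them.  The set of
events is finite; it is non-empty because it is only used together with a designated event. -/
structure EventFrame (Agent : Type u) where
  Event : Type
  finite : Finite Event
  rel : Agent → Event → Event → Prop

/-- Formulas of the language with assignments and event models.  An event model consists of an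
event frame `F` and a precondition formula `pre f` for every event `f`; the formula
`event F pre e φ` is `[ℰ, e] φ` for the event model `ℰ = (F, pre)`, and `assign x t φ` is
`[x := t] φ`. -/
inductive Formula (S : Signature.{u}) : Type (max u 1) where
  | eq (t t' : Term S) : Formula S
  | pred (P : S.Pred) (ts : Fin (S.arity P) → Term S) : Formula S
  | neg (φ : Formula S) : Formula S
  | and (φ ψ : Formula S) : Formula S
  | know (i : S.Agent) (φ : Formula S) : Formula S
  | assign (x : S.Var) (t : Term S) (φ : Formula S) : Formula S
  | event (F : EventFrame S.Agent) (pre : F.Event → Formula S) (e : F.Event)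
      (φ : Formula S) : Formula S

/-! ### Abbreviations -/

namespace Formula

variable {S : Signature.{u}}

/-- Implication. -/
def imp (φ ψ : Formula S) : Formula S := neg (and φ (neg ψ))

/-- Biconditional. -/
def iff (φ ψ : Formula S) : Formula S := and (imp φ ψ) (imp ψ φ)

/-- The dual `⟨x := t⟩ φ` of the assignment operator. -/
def dassign (x : S.Var) (t : Term S) (φ : Formula S) : Formula S := neg (assign x t (neg φ))

/-- The constant `⊤`, as the tautology `v ≈ v → v ≈ v` for some variable `v`. -/
noncomputable def top [h : Nonempty S.Var] : Formula S :=
  imp (eq (.var h.some) (.var h.some)) (eq (.var h.some) (.var h.some))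

/-- Finite conjunction; the empty one is `⊤`. -/
noncomputable def conj [Nonempty S.Var] : List (Formula S) → Formula S
  | [] => top
  | φ :: l => and φ (conj l)

/-- Atomic formulas. -/
inductive IsAtomic : Formula S → Prop where
  | eq (t t' : Term S) : IsAtomic (eq t t')
  | pred (P : S.Pred) (ts : Fin (S.arity P) → Term S) : IsAtomic (pred P ts)

end Formula

/-! ### Occurrences of variables and renaming -/

/-- The set of variables of a term. -/
def Term.vars {S : Signature.{u}} : Term S → Set S.Var
  | .var x => {x}
  | .name _ => ∅

open Classical in
/-- The term `t[y/x]`. -/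
noncomputable def Term.rename {S : Signature.{u}} (x y : S.Var) : Term S → Term S
  | .var z => if z = x then .var y else .var z
  | .name a => .name a

namespace Formula

variable {S : Signature.{u}}

/-- The free variables of a formula: `[x := t]` binds `x` in its scope (but not in `t`), and an
event update binds nothing. -/
def fv : Formula S → Set S.Var
  | eq t t' => t.vars ∪ t'.vars
  | pred _ ts => ⋃ k, (ts k).vars
  | neg φ => fv φ
  | and φ ψ => fv φ ∪ fv ψ
  | know _ φ => fv φ
  | assign x t φ => (fv φ \ {x}) ∪ t.vars
  | event _ pre _ φ => (⋃ f, fv (pre f)) ∪ fv φ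

/-- All variables that occur in a formula, free or bound, also inside preconditions. -/
def vars : Formula S → Set S.Var
  | eq t t' => t.vars ∪ t'.vars
  | pred _ ts => ⋃ k, (ts k).vars
  | neg φ => vars φ
  | and φ ψ => vars φ ∪ vars ψ
  | know _ φ => vars φ
  | assign x t φ => {x} ∪ t.vars ∪ vars φ
  | event _ pre _ φ => (⋃ f, vars (pre f)) ∪ vars φ

open Classical in
/-- `φ.rename x y` is `φ[y/x]`: all free occurrences of `x` in `φ` are replaced by `y`. -/
noncomputable def rename (x y : S.Var) : Formula S → Formula S
  | eq t t' => eq (t.rename x y) (t'.rename x y)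
  | pred P ts => pred P (fun k => (ts k).rename x y)
  | neg φ => neg (rename x y φ)
  | and φ ψ => and (rename x y φ) (rename x y ψ)
  | know i φ => know i (rename x y φ)
  | assign z t φ => assign z (t.rename x y) (if z = x then φ else rename x y φ)
  | event F pre e φ => event F (fun f => rename x y (pre f)) e (rename x y φ)

/-- `φ.Admissible x y` says that `φ[y/x]` is admissible: every occurrence of `y` that replaces a
free occurrence of `x` in `φ` is free in `φ[y/x]`. -/
def Admissible (x y : S.Var) : Formula S → Prop
  | eq _ _ => True
  | pred _ _ => True
  | neg φ => Admissible x y φ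
  | and φ ψ => Admissible x y φ ∧ Admissible x y ψ
  | know _ φ => Admissible x y φ
  | assign z _ φ => z = x ∨ (Admissible x y φ ∧ (z = y → x ∉ fv φ))
  | event _ pre _ φ => (∀ f, Admissible x y (pre f)) ∧ Admissible x y φ

end Formula

/-! ### Semantics -/

/-- Constant-domain Kripke models.  The sets of worlds and of objects are non-empty wherever
satisfaction is considered, since there a world and an assignment are given. -/
structure Model (S : Signature.{u}) where
  World : Type u
  Dom : Type u
  rel : S.Agent → World → World → Prop
  rho : (P : S.Pred) → World → Set (Fin (S.arity P) → Dom)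
  eta : S.Name → World → Dom

/-- Epistemic models: all accessibility relations are equivalence relations. -/
def Model.IsEpistemic {S : Signature.{u}} (M : Model S) : Prop :=
  ∀ i, Equivalence (M.rel i)

/-- The value `σ_w(t)` of a term at a world. -/
def Term.val {S : Signature.{u}} (M : Model S) (w : M.World) (σ : S.Var → M.Dom) :
    Term S → M.Dom
  | .var x => σ x
  | .name a => M.eta a w

/-- The update product of a model with an event frame, where `ok v f` says that the precondition
of the event `f` is true at the world `v`. -/
abbrev Model.update {S : Signature.{u}} (M : Model S) (F : EventFrame S.Agent)
    (ok : M.World → F.Event → Prop) : Model S where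
  World := {p : M.World × F.Event // ok p.1 p.2}
  Dom := M.Dom
  rel i p q := M.rel i p.1.1 q.1.1 ∧ F.rel i p.1.2 q.1.2
  rho P p := M.rho P p.1.1
  eta a p := M.eta a p.1.1

open Classical in
/-- `Sat φ M w σ` is `M, w, σ ⊨ φ`. -/
def Sat {S : Signature.{u}} :
    Formula S → (M : Model S) → M.World → (S.Var → M.Dom) → Prop
  | .eq t t', M, w, σ => t.val M w σ = t'.val M w σ
  | .pred P ts, M, w, σ => (fun k => (ts k).val M w σ) ∈ M.rho P w
  | .neg φ, M, w, σ => ¬ Sat φ M w σ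
  | .and φ ψ, M, w, σ => Sat φ M w σ ∧ Sat ψ M w σ
  | .know i φ, M, w, σ => ∀ v, M.rel i w v → Sat φ M v σ
  | .assign x t φ, M, w, σ => Sat φ M w (Function.update σ x (t.val M w σ))
  | .event F pre e φ, M, w, σ => ∀ h : Sat (pre e) M w σ,
      Sat φ (M.update F (fun v f => Sat (pre f) M v σ)) ⟨(w, e), h⟩ σ

/-- Validity over arbitrary models. -/
def Valid {S : Signature.{u}} (φ : Formula S) : Prop :=
  ∀ (M : Model S) (w : M.World) (σ : S.Var → M.Dom), Sat φ M w σ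

/-- Validity over epistemic models. -/
def EpistemicValid {S : Signature.{u}} (φ : Formula S) : Prop :=
  ∀ M : Model S, M.IsEpistemic → ∀ (w : M.World) (σ : S.Var → M.Dom), Sat φ M w σ

/-! ### Proof systems -/

/-- Instances of propositional tautologies: formulas that are true under every valuation of the
formulas which respects negation and conjunction. -/
def IsTautology {S : Signature.{u}} (φ : Formula S) : Prop :=
  ∀ v : Formula S → Prop, (∀ ψ, v (.neg ψ) ↔ ¬ v ψ) →
    (∀ ψ χ, v (.and ψ χ) ↔ v ψ ∧ v χ) → v φ

/-- The frame of the composition of two event models. -/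
def EventFrame.comp {Agent : Type u} (F G : EventFrame Agent) : EventFrame Agent where
  Event := F.Event × G.Event
  finite := by
    have := F.finite
    have := G.finite
    infer_instance
  rel i p q := F.rel i p.1 q.1 ∧ G.rel i p.2 q.2

/-- The preconditions of the composition of two event models. -/
def compPre {S : Signature.{u}} (F G : EventFrame S.Agent) (pre : F.Event → Formula S)
    (pre' : G.Event → Formula S) : (F.comp G).Event → Formula S :=
  fun p => .and (pre p.1) (.event F pre p.1 (pre' p.2))

/-- The S5 axioms. -/
inductive S5Axiom {S : Signature.{u}} : Formula S → Prop where
  | t (i : S.Agent) (φ : Formula S) : S5Axiom ((Formula.know i φ).imp φ)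
  | four (i : S.Agent) (φ : Formula S) : S5Axiom ((Formula.know i φ).imp (.know i (.know i φ)))
  | five (i : S.Agent) (φ : Formula S) :
      S5Axiom ((Formula.neg (.know i φ)).imp (.know i (.neg (.know i φ))))

section Systems

variable {S : Signature.{u}} [Nonempty S.Var]

open Formula

/-- The axioms of the basic system, for all formulas of the language. -/
inductive BasicAxiom : Formula S → Prop where
  | taut (φ : Formula S) (h : IsTautology φ) : BasicAxiom φ
  | distK (i : S.Agent) (φ ψ : Formula S) :
      BasicAxiom (imp (know i (imp φ ψ)) (imp (know i φ) (know i ψ)))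
  | id (t : Term S) : BasicAxiom (eq t t)
  | sym (t t' : Term S) : BasicAxiom (iff (eq t t') (eq t' t))
  | trans (t t' t'' : Term S) : BasicAxiom (imp (and (eq t t') (eq t' t'')) (eq t t''))
  | subAs (x : S.Var) (t t' : Term S) (φ : Formula S) :
      BasicAxiom (imp (eq t t') (iff (assign x t φ) (assign x t' φ)))
  | subP (P : S.Pred) (ts ts' : Fin (S.arity P) → Term S) :
      BasicAxiom (imp (conj (List.ofFn fun k => eq (ts k) (ts' k)))
        (iff (pred P ts) (pred P ts')))
  | rigidP (i : S.Agent) (x y : S.Var) :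
      BasicAxiom (imp (eq (.var x) (.var y)) (know i (eq (.var x) (.var y))))
  | rigidN (i : S.Agent) (x y : S.Var) :
      BasicAxiom (imp (neg (eq (.var x) (.var y))) (know i (neg (eq (.var x) (.var y)))))
  | kAs (x : S.Var) (t : Term S) (φ ψ : Formula S) :
      BasicAxiom (imp (assign x t (imp φ ψ)) (imp (assign x t φ) (assign x t ψ)))
  | detAs (x : S.Var) (t : Term S) (φ : Formula S) :
      BasicAxiom (imp (dassign x t φ) (assign x t φ))
  | dAs (x : S.Var) (t : Term S) : BasicAxiom (dassign x t top)
  | efAs (x : S.Var) (t : Term S) : BasicAxiom (assign x t (eq (.var x) t))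
  | sub2As (x y : S.Var) (φ : Formula S) (h : φ.Admissible x y) :
      BasicAxiom (imp (φ.rename x y) (assign x (.var y) φ))

/-- The reduction axioms for event updates.  In `uK` the list `l` enumerates the events accessible
from `e` for agent `i`. -/
inductive ReductionAxiom : Formula S → Prop where
  | uAtom (F : EventFrame S.Agent) (pre : F.Event → Formula S) (e : F.Event) (p : Formula S)
      (hp : p.IsAtomic) : ReductionAxiom (iff (event F pre e p) (imp (pre e) p))
  | uNeg (F : EventFrame S.Agent) (pre : F.Event → Formula S) (e : F.Event) (φ : Formula S) :
      ReductionAxiom (iff (event F pre e (neg φ)) (imp (pre e) (neg (event F pre e φ))))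
  | uCon (F : EventFrame S.Agent) (pre : F.Event → Formula S) (e : F.Event) (φ ψ : Formula S) :
      ReductionAxiom (iff (event F pre e (and φ ψ)) (and (event F pre e φ) (event F pre e ψ)))
  | uK (F : EventFrame S.Agent) (pre : F.Event → Formula S) (e : F.Event) (i : S.Agent)
      (φ : Formula S) (l : List F.Event) (hl : ∀ f, f ∈ l ↔ F.rel i e f) :
      ReductionAxiom (iff (event F pre e (know i φ))
        (imp (pre e) (conj (l.map fun f => know i (event F pre f φ)))))
  | uCom (F G : EventFrame S.Agent) (pre : F.Event → Formula S) (pre' : G.Event → Formula S)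
      (e : F.Event) (e' : G.Event) (φ : Formula S) :
      ReductionAxiom (iff (event F pre e (event G pre' e' φ))
        (event (F.comp G) (compPre F G pre pre') (e, e') φ))
  | uAssi (F : EventFrame S.Agent) (pre : F.Event → Formula S) (e : F.Event) (x z : S.Var)
      (t : Term S) (φ : Formula S) (hφ : z ∉ φ.vars) (ht : z ∉ t.vars)
      (hpre : ∀ f, z ∉ (pre f).vars) :
      ReductionAxiom (iff (event F pre e (assign x t φ))
        (assign z (.var x) (assign x t (event F (fun f => (pre f).rename x z) e φ))))

end Systems

/-- Theorems of the system with the axioms `Ax` and the rules of necessitation for the epistemic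
operators, modus ponens, and the introduction of assignments in the consequent. -/
inductive Derivable {S : Signature.{u}} (Ax : Formula S → Prop) : Formula S → Prop where
  | ax (φ : Formula S) (h : Ax φ) : Derivable Ax φ
  | necK (i : S.Agent) (φ : Formula S) (h : Derivable Ax φ) : Derivable Ax (.know i φ)
  | mp (φ ψ : Formula S) (h : Derivable Ax φ) (h' : Derivable Ax (φ.imp ψ)) : Derivable Ax ψ
  | necAs (x : S.Var) (t : Term S) (φ ψ : Formula S) (hx : x ∉ φ.fv)
      (h : Derivable Ax (φ.imp ψ)) : Derivable Ax (φ.imp (.assign x t ψ))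

/-- Provability in the dynamic system for arbitrary models: the basic system extended with the
reduction axioms. -/
def SDELAS {S : Signature.{u}} [Nonempty S.Var] (φ : Formula S) : Prop :=
  Derivable (fun χ => BasicAxiom χ ∨ ReductionAxiom χ) φ

/-- Provability in the dynamic system for epistemic models: the basic system with the S5 axioms,
extended with the reduction axioms. -/
def SDELAS5 {S : Signature.{u}} [Nonempty S.Var] (φ : Formula S) : Prop :=
  Derivable (fun χ => BasicAxiom χ ∨ S5Axiom χ ∨ ReductionAxiom χ) φ

end DELAS

set_option linter.unusedSectionVars false

namespace DELAS

variable {S : Signature.{u}}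

/-! ### Semantics -/

/-! The reduction axioms remove event updates: `reducible_aux` gives every formula a static formula
equivalent to it both provably and semantically. A valid formula thus has a valid static equivalent,
and completeness is only needed for static formulas, where it comes from canonical models built of
maximal consistent sets.

There are no quantifiers, but names are not rigid, so the theory of a world must equate each name in
play with some variable, called a parameter. By `SFormula.exists_disjoint` parameters can be kept
apart from bound variables; assignments then act as substitutions of parameters, and the truth lemma
`Canonical.sat_iff` goes through.

Over arbitrary models (`static_complete`) a world is a theory with a finite set of parameters that
may grow along accessibility. A name equal to no old parameter gets a fresh variable, whose object
is reserved in advance, so the domain stays constant.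

Over epistemic models (`static_complete_epistemic`) symmetry forbids such growth. All worlds share
one infinite set of parameters, and theories are `Rich`: closed under an infinitary rule that
provides witnesses inside all necessity forms. If a theory is rich, then the formulas known in it
can again be extended to rich theories (`Rich.extendable`, `exists_rich`), by a Rasiowa–Sikorski
argument over a countable vocabulary. -/

@[simp] theorem Term.val_update (M : Model S) (F : EventFrame S.Agent)
    (ok : M.World → F.Event → Prop) (p : (M.update F ok).World) (σ : S.Var → M.Dom) (t : Term S) :
    t.val (M.update F ok) p σ = t.val M p.1.1 σ := by
  cases t <;> rfl

theorem Term.val_congr {M : Model S} {w : M.World} {σ σ' : S.Var → M.Dom} {t : Term S}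
    (h : ∀ x ∈ t.vars, σ x = σ' x) : t.val M w σ = t.val M w σ' := by
  cases t with
  | var x => exact h x rfl
  | name a => rfl

open Classical in
theorem Term.val_rename {M : Model S} {w : M.World} {σ : S.Var → M.Dom} {x z : S.Var}
    (t : Term S) :
    (t.rename x z).val M w σ = t.val M w (Function.update σ x (σ z)) := by
  cases t with
  | var y =>
    by_cases h : y = x
    · subst h; simp [Term.rename, Term.val]
    · simp [Term.rename, Term.val, h]
  | name a => rfl

theorem sat_event_iff {M : Model S} {w : M.World} {σ : S.Var → M.Dom} {F : EventFrame S.Agent}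
    {pre : F.Event → Formula S} {e : F.Event} {φ : Formula S} :
    Sat (.event F pre e φ) M w σ ↔ ∀ h : Sat (pre e) M w σ,
      Sat φ (M.update F (fun v f => Sat (pre f) M v σ)) ⟨(w, e), h⟩ σ :=
  Iff.rfl

/-- The type of worlds of the update depends on `ok`, so equivalent preconditions cannot be
rewritten in place. With `ok` a variable, they become equal and can be substituted. -/
theorem sat_update_congr {M : Model S} {F : EventFrame S.Agent} {ok ok' : M.World → F.Event → Prop}
    {w : M.World} {e : F.Event} {φ φ' : Formula S} {σ σ' : S.Var → M.Dom}
    (hok : ∀ v f, ok v f ↔ ok' v f)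
    (h : ∀ (o : M.World → F.Event → Prop) (q : o w e),
      Sat φ (M.update F o) ⟨(w, e), q⟩ σ ↔ Sat φ' (M.update F o) ⟨(w, e), q⟩ σ') :
    (∀ q : ok w e, Sat φ (M.update F ok) ⟨(w, e), q⟩ σ) ↔
      ∀ q : ok' w e, Sat φ' (M.update F ok') ⟨(w, e), q⟩ σ' := by
  obtain rfl : ok = ok' := by ext v f; exact hok v f
  exact forall_congr' fun q => h ok q

theorem sat_event_congr {M : Model S} {F : EventFrame S.Agent} {pre pre' : F.Event → Formula S}
    {w : M.World} {e : F.Event} {φ φ' : Formula S} {σ σ' τ τ' : S.Var → M.Dom}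
    (hpre : ∀ v f, Sat (pre f) M v σ ↔ Sat (pre' f) M v σ')
    (h : ∀ (o : M.World → F.Event → Prop) (q : o w e),
      Sat φ (M.update F o) ⟨(w, e), q⟩ τ ↔ Sat φ' (M.update F o) ⟨(w, e), q⟩ τ') :
    (∀ q : Sat (pre e) M w σ,
      Sat φ (M.update F (fun v f => Sat (pre f) M v σ)) ⟨(w, e), q⟩ τ) ↔
    ∀ q : Sat (pre' e) M w σ',
      Sat φ' (M.update F (fun v f => Sat (pre' f) M v σ')) ⟨(w, e), q⟩ τ' :=
  sat_update_congr (ok := fun v f => Sat (pre f) M v σ) (ok' := fun v f => Sat (pre' f) M v σ')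
    hpre h

/-- The truth value of a formula depends only on the values of its free variables. -/
theorem sat_congr (φ : Formula S) : ∀ {M : Model S} {w : M.World} {σ σ' : S.Var → M.Dom},
    (∀ x ∈ φ.fv, σ x = σ' x) → (Sat φ M w σ ↔ Sat φ M w σ') := by
  induction φ with
  | eq t t' =>
    intro M w σ σ' h
    simp only [Sat]
    rw [Term.val_congr (t := t) fun x hx => h x (Or.inl hx),
      Term.val_congr (t := t') fun x hx => h x (Or.inr hx)]
  | pred P ts =>
    intro M w σ σ' h
    have : (fun k => (ts k).val M w σ) = fun k => (ts k).val M w σ' := by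
      funext k
      exact Term.val_congr fun x hx => h x (Set.mem_iUnion.2 ⟨k, hx⟩)
    simp only [Sat, this]
  | neg φ ih => intro M w σ σ' h; exact not_congr (ih h)
  | and φ ψ ih1 ih2 =>
    intro M w σ σ' h
    exact and_congr (ih1 fun x hx => h x (Or.inl hx)) (ih2 fun x hx => h x (Or.inr hx))
  | know i φ ih => intro M w σ σ' h; exact forall₂_congr fun v _ => ih h
  | assign y t φ ih =>
    intro M w σ σ' h
    refine ih fun x hx => ?_
    by_cases hxy : x = y
    · subst hxy
      simpa using Term.val_congr fun x hx => h x (Or.inr hx)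
    · simpa [hxy] using h x (Or.inl ⟨hx, hxy⟩)
  | event F pre e φ ihp ih =>
    intro M w σ σ' h
    rw [sat_event_iff, sat_event_iff]
    exact sat_event_congr
      (fun v f => ihp f fun x hx => h x (Or.inl (Set.mem_iUnion.2 ⟨f, hx⟩)))
      (fun o q => ih fun x hx => h x (Or.inr hx))

theorem Formula.fv_subset_vars (φ : Formula S) : φ.fv ⊆ φ.vars := by
  induction φ with
  | eq t t' => exact subset_rfl
  | pred P ts => exact subset_rfl
  | neg φ ih => exact ih
  | and φ ψ ih1 ih2 => exact Set.union_subset_union ih1 ih2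
  | know i φ ih => exact ih
  | assign y t φ ih =>
    rintro x (hx | hx)
    · exact Or.inr (ih hx.1)
    · exact Or.inl (Or.inr hx)
  | event F pre e φ ihp ih => exact Set.union_subset_union (Set.iUnion_mono ihp) ih

open Classical in
/-- Truth of a formula in which a variable has been replaced by a fresh one. -/
theorem sat_rename (φ : Formula S) {x z : S.Var} : ∀ {M : Model S} {w : M.World}
    {σ : S.Var → M.Dom}, z ∉ φ.vars →
    (Sat (φ.rename x z) M w σ ↔ Sat φ M w (Function.update σ x (σ z))) := by
  induction φ with
  | eq t t' =>
    intro M w σ _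
    simp only [Formula.rename, Sat, Term.val_rename]
  | pred P ts =>
    intro M w σ _
    simp only [Formula.rename, Sat, Term.val_rename]
  | neg φ ih => intro M w σ h; exact not_congr (ih h)
  | and φ ψ ih1 ih2 =>
    intro M w σ h
    exact and_congr (ih1 fun hx => h (Or.inl hx)) (ih2 fun hx => h (Or.inr hx))
  | know i φ ih => intro M w σ h; exact forall₂_congr fun v _ => ih h
  | assign y t φ ih =>
    intro M w σ h
    have hzy : z ≠ y := fun e => h (Or.inl (Or.inl e))
    have hφ : z ∉ φ.vars := fun e => h (Or.inr e)
    simp only [Formula.rename, Sat, Term.val_rename]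
    split_ifs with hyx
    · subst hyx; simp
    · rw [ih hφ, Function.update_of_ne hzy, Function.update_comm hyx]
  | event F pre e φ ihp ih =>
    intro M w σ h
    have h1 : ∀ f, z ∉ (pre f).vars := fun f hf => h (Or.inl (Set.mem_iUnion.2 ⟨f, hf⟩))
    have h2 : z ∉ φ.vars := fun hx => h (Or.inr hx)
    rw [Formula.rename, sat_event_iff, sat_event_iff]
    exact sat_event_congr (fun v f => ihp f (h1 f)) (fun o q => ih (M := M.update F o) h2)

/-! ### Invariance under duplicating worlds -/

/-- The model with the set of worlds `W`, each world `w` being a copy of the world `g w`. -/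
def Model.pull (M : Model S) {W : Type u} (g : W → M.World) : Model S where
  World := W
  Dom := M.Dom
  rel i v w := M.rel i (g v) (g w)
  rho P w := M.rho P (g w)
  eta a w := M.eta a (g w)

@[simp] theorem Term.val_pull (M : Model S) {W : Type u} (g : W → M.World) (w : W)
    (σ : S.Var → M.Dom) (t : Term S) : t.val (M.pull g) w σ = t.val M (g w) σ := by
  cases t <;> rfl

/-- Surjectivity makes every successor of `g w` the image of a successor of `w`. The lemma serves to
compare update products whose worlds are the same only up to re-bracketing. -/
theorem sat_pull (φ : Formula S) : ∀ {M : Model S} {W : Type u} {g : W → M.World}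
    (_ : Function.Surjective g) (w : W) (σ : S.Var → M.Dom),
    Sat φ (M.pull g) w σ ↔ Sat φ M (g w) σ := by
  induction φ with
  | eq t t' =>
    intro M W g hg w σ
    change t.val (M.pull g) w σ = t'.val (M.pull g) w σ ↔ _
    rw [Term.val_pull, Term.val_pull]
    rfl
  | pred P ts =>
    intro M W g hg w σ
    have : (fun k => (ts k).val (M.pull g) w σ) = fun k => (ts k).val M (g w) σ := by
      funext k
      exact Term.val_pull M g w σ (ts k)
    change (fun k => (ts k).val (M.pull g) w σ) ∈ M.rho P (g w) ↔ _
    rw [this]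
    rfl
  | neg φ ih => intro M W g hg w σ; exact not_congr (ih hg w σ)
  | and φ ψ ih1 ih2 => intro M W g hg w σ; exact and_congr (ih1 hg w σ) (ih2 hg w σ)
  | know i φ ih =>
    intro M W g hg w σ
    refine Iff.trans ?_ (hg.forall (p := fun v => M.rel i (g w) v → Sat φ M v σ)).symm
    exact forall_congr' fun v => imp_congr Iff.rfl (ih hg v σ)
  | assign y t φ ih =>
    intro M W g hg w σ
    refine Iff.trans (ih hg w _) ?_
    rw [Term.val_pull]
    rfl
  | event F pre e φ ihp ih =>
    intro M W g hg w σ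
    have key : (∀ q : Sat (pre e) M (g w) σ,
        Sat φ ((M.pull g).update F (fun v f => Sat (pre f) M (g v) σ)) ⟨(w, e), q⟩ σ) ↔
        Sat (.event F pre e φ) M (g w) σ := by
      refine forall_congr' fun q => ?_
      -- The update of the pulled-back model is the pull-back of the update along `k`, so the
      -- induction hypothesis applies to `k`.
      let k : {p : W × F.Event // Sat (pre p.2) M (g p.1) σ} →
          (M.update F (fun v f => Sat (pre f) M v σ)).World := fun p => ⟨(g p.1.1, p.1.2), p.2⟩
      have hk : Function.Surjective k := by
        rintro ⟨⟨v, f⟩, hv⟩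
        obtain ⟨v, rfl⟩ := hg v
        exact ⟨⟨(v, f), hv⟩, rfl⟩
      exact ih (M := M.update F (fun v f => Sat (pre f) M v σ)) hk ⟨(w, e), q⟩ σ
    refine Iff.trans ?_ key
    exact sat_update_congr (M := M.pull g) (ok := fun v f => Sat (pre f) (M.pull g) v σ)
      (ok' := fun v f => Sat (pre f) M (g v) σ) (fun v f => ihp f hg v σ) (fun o q => Iff.rfl)

/-- Soundness of the composition axiom. -/
theorem sat_comp {F G : EventFrame S.Agent} {pre : F.Event → Formula S}
    {pre' : G.Event → Formula S} {e : F.Event} {e' : G.Event} {φ : Formula S} {M : Model S}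
    {w : M.World} {σ : S.Var → M.Dom} :
    Sat (.event F pre e (.event G pre' e' φ)) M w σ ↔
      Sat (.event (F.comp G) (compPre F G pre pre') (e, e') φ) M w σ := by
  let ok : M.World → F.Event → Prop := fun v f => Sat (pre f) M v σ
  let ok' : (M.update F ok).World → G.Event → Prop := fun v f => Sat (pre' f) (M.update F ok) v σ
  let okc : M.World → (F.comp G).Event → Prop := fun v f => Sat (compPre F G pre pre' f) M v σ
  -- `k` sends `((v, f), f')` to `(v, (f, f'))`.
  let k : ((M.update F ok).update G ok').World → (M.update (F.comp G) okc).World :=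
    fun p => ⟨(p.1.1.1.1, (p.1.1.1.2, p.1.2)), ⟨p.1.1.2, fun _ => p.2⟩⟩
  have hk : Function.Surjective k := by
    rintro ⟨⟨v, f, f'⟩, hv⟩
    exact ⟨⟨(⟨(v, f), hv.1⟩, f'), hv.2 hv.1⟩, rfl⟩
  -- The relations of the two models differ only by the bracketing of a conjunction.
  have hsat : ∀ p, Sat φ ((M.update F ok).update G ok') p σ ↔
      Sat φ ((M.update (F.comp G) okc).pull k) p σ := by
    intro p
    have : ∀ r : S.Agent → ((M.update F ok).update G ok').World →
        ((M.update F ok).update G ok').World → Prop,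
        (∀ i p q, ((M.update F ok).update G ok').rel i p q ↔ r i p q) →
        (Sat φ ((M.update F ok).update G ok') p σ ↔
          Sat φ { (M.update F ok).update G ok' with rel := r } p σ) := by
      intro r hr
      obtain rfl : ((M.update F ok).update G ok').rel = r := by
        ext i p q
        exact hr i p q
      rfl
    exact this _ fun i p q => and_assoc
  constructor
  · rintro h ⟨h1, h2⟩
    exact (sat_pull φ hk ⟨(⟨(w, e), h1⟩, e'), h2 h1⟩ σ).1 ((hsat _).1 (h h1 (h2 h1)))
  · intro h h1 h2
    exact (hsat _).2 ((sat_pull φ hk ⟨(⟨(w, e), h1⟩, e'), h2⟩ σ).2 (h ⟨h1, fun _ => h2⟩))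

open Classical in
/-- Soundness of the assignment axiom for event updates. -/
theorem sat_event_assign {F : EventFrame S.Agent} {pre : F.Event → Formula S} {e : F.Event}
    {x z : S.Var} {t : Term S} {φ : Formula S} (hφ : z ∉ φ.vars) (ht : z ∉ t.vars)
    (hpre : ∀ f, z ∉ (pre f).vars) {M : Model S} {w : M.World} {σ : S.Var → M.Dom} :
    Sat (.event F pre e (.assign x t φ)) M w σ ↔
      Sat (.assign z (.var x) (.assign x t (.event F (fun f => (pre f).rename x z) e φ)))
        M w σ := by
  have hval : t.val M w (Function.update σ z (σ x)) = t.val M w σ :=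
    Term.val_congr fun y hy => Function.update_of_ne (by rintro rfl; exact ht hy) _ _
  have hl : Sat (.event F pre e (.assign x t φ)) M w σ ↔ ∀ h : Sat (pre e) M w σ,
      Sat φ (M.update F (fun v f => Sat (pre f) M v σ)) ⟨(w, e), h⟩
        (Function.update σ x (t.val M w σ)) := by
    rw [sat_event_iff]
    refine forall_congr' fun q => ?_
    rw [Sat, Term.val_update]
  rw [hl]
  change _ ↔ Sat (.event F (fun f => (pre f).rename x z) e φ) M w
    (Function.update (Function.update σ z (σ x)) x (t.val M w (Function.update σ z (σ x))))
  rw [hval, sat_event_iff]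
  -- The renamed preconditions read the old value of `x`, saved in `z`, while `φ` sees the new value
  -- of `x` and does not mention `z`.
  refine sat_event_congr (pre' := fun f => (pre f).rename x z) (fun v f => ?_) (fun o q => sat_congr φ fun y hy => ?_)
  · rw [sat_rename _ (hpre f)]
    refine sat_congr _ fun y hy => ?_
    have hyz : y ≠ z := by rintro rfl; exact hpre f ((pre f).fv_subset_vars hy)
    by_cases hyx : y = x
    · subst hyx
      simp [Ne.symm hyz]
    · simp [hyx, hyz]
  · have hyz : y ≠ z := by rintro rfl; exact hφ (φ.fv_subset_vars hy)
    by_cases hyx : y = x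
    · subst hyx; simp
    · simp [hyx, hyz]

end DELAS

namespace DELAS

variable {S : Signature.{u}}

/-! ### Derivations -/

/-- Valuations of the formulas that respect negation and conjunction. -/
structure Respects (v : Formula S → Prop) : Prop where
  neg : ∀ ψ, v (.neg ψ) ↔ ¬ v ψ
  and : ∀ ψ χ, v (.and ψ χ) ↔ v ψ ∧ v χ

namespace Respects

variable {v : Formula S → Prop} (hv : Respects v)
include hv

theorem imp (ψ χ : Formula S) : v (ψ.imp χ) ↔ (v ψ → v χ) := by
  simp only [Formula.imp, hv.neg, hv.and]; tauto

theorem iff (ψ χ : Formula S) : v (ψ.iff χ) ↔ (v ψ ↔ v χ) := by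
  simp only [Formula.iff, hv.and, hv.imp]; tauto

end Respects

open Formula

variable [Infinite S.Var]

/-- The sets of axioms that contain the axioms of the basic system. -/
class Basic (Ax : Formula S → Prop) : Prop where
  basic : ∀ χ, BasicAxiom χ → Ax χ

variable {Ax : Formula S → Prop} [Basic Ax] {a b c d : Formula S}


theorem Derivable.mp' (h : Derivable Ax (a.imp b)) (h' : Derivable Ax a) : Derivable Ax b := .mp _ _ h' h

theorem Derivable.basic (h : BasicAxiom a) : Derivable Ax a := .ax _ (Basic.basic _ h)

/-- Here and below, propositional steps are justified by checking all valuations in Lean's own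
logic, usually with `tauto`. -/
theorem Derivable.taut (h : ∀ v, Respects v → v a) : Derivable Ax a :=
  .basic (.taut _ fun v h1 h2 => h v ⟨h1, h2⟩)

theorem Derivable.taut1 (ha : Derivable Ax a) (h : ∀ v, Respects v → v a → v b) : Derivable Ax b :=
  .mp' (.taut fun v hv => (hv.imp _ _).2 (h v hv)) ha

theorem Derivable.taut2 (ha : Derivable Ax a) (hb : Derivable Ax b) (h : ∀ v, Respects v → v a → v b → v c) : Derivable Ax c :=
  .mp' (.taut1 ha fun v hv h1 => (hv.imp _ _).2 (h v hv h1)) hb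

theorem Derivable.taut3 (ha : Derivable Ax a) (hb : Derivable Ax b) (hc : Derivable Ax c)
    (h : ∀ v, Respects v → v a → v b → v c → v d) : Derivable Ax d :=
  .mp' (.taut2 ha hb fun v hv h1 h2 => (hv.imp _ _).2 (h v hv h1 h2)) hc

theorem Derivable.imp_trans (h1 : Derivable Ax (a.imp b)) (h2 : Derivable Ax (b.imp c)) : Derivable Ax (a.imp c) :=
  .taut2 h1 h2 fun v hv => by simp only [hv.imp]; tauto

theorem Derivable.iff_trans (h1 : Derivable Ax (a.iff b)) (h2 : Derivable Ax (b.iff c)) : Derivable Ax (a.iff c) :=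
  .taut2 h1 h2 fun v hv => by simp only [hv.iff]; tauto

theorem Derivable.iff_of_imp (h1 : Derivable Ax (a.imp b)) (h2 : Derivable Ax (b.imp a)) : Derivable Ax (a.iff b) :=
  .taut2 h1 h2 fun v hv => by simp only [hv.iff, hv.imp]; tauto

theorem Derivable.iff_left (h1 : Derivable Ax (a.iff b)) : Derivable Ax (a.imp b) :=
  .taut1 h1 fun v hv => by simp only [hv.iff, hv.imp]; tauto

theorem Derivable.iff_right (h1 : Derivable Ax (a.iff b)) : Derivable Ax (b.imp a) :=
  .taut1 h1 fun v hv => by simp only [hv.iff, hv.imp]; tauto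

theorem Derivable.know_imp (i : S.Agent) (h : Derivable Ax (a.imp b)) : Derivable Ax ((know i a).imp (know i b)) :=
  .mp' (.basic (.distK i a b)) (.necK i _ h)

theorem Derivable.know_iff (i : S.Agent) (h : Derivable Ax (a.iff b)) : Derivable Ax ((know i a).iff (know i b)) :=
  .iff_of_imp (.know_imp i h.iff_left) (.know_imp i h.iff_right)

/-- Assignments whose variable is not free in the scope can be introduced and eliminated. -/
theorem Derivable.imp_assign_of_notMem {x : S.Var} (t : Term S) (hx : x ∉ a.fv) :
    Derivable Ax (a.imp (assign x t a)) :=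
  .necAs x t a a hx (.taut fun v hv => by simp only [hv.imp]; tauto)

/-- The rule only introduces an assignment behind an antecedent in which `x` is not free; `y ≈ y`
with `y ≠ x` is a provable one. -/
theorem Derivable.nec_assign (x : S.Var) (t : Term S) (h : Derivable Ax a) : Derivable Ax (assign x t a) := by
  obtain ⟨y, hy⟩ := exists_ne x
  have h1 : Derivable Ax (eq (.var y) (.var y)) := .basic (.id _)
  refine .mp' (.necAs x t _ a ?_ (.taut1 h fun v hv h => (hv.imp _ _).2 fun _ => h)) h1
  simpa [fv, Term.vars] using hy.symm

theorem Derivable.assign_imp (x : S.Var) (t : Term S) (h : Derivable Ax (a.imp b)) :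
    Derivable Ax ((assign x t a).imp (assign x t b)) :=
  .mp' (.basic (.kAs x t a b)) (.nec_assign x t h)

theorem Derivable.assign_iff (x : S.Var) (t : Term S) (h : Derivable Ax (a.iff b)) :
    Derivable Ax ((assign x t a).iff (assign x t b)) :=
  .iff_of_imp (.assign_imp x t h.iff_left) (.assign_imp x t h.iff_right)

/-- Assignments are functional: `dAs` excludes that `a` and its negation both hold after the
assignment, and `detAs` that neither does. -/
theorem Derivable.assign_neg (x : S.Var) (t : Term S) (a : Formula S) :
    Derivable Ax ((assign x t (neg a)).iff (neg (assign x t a))) := by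
  have h1 : Derivable Ax (imp (assign x t a) (imp (assign x t (neg a)) (assign x t (neg top)))) :=
    .imp_trans (.assign_imp x t (.taut fun v hv => by simp only [hv.imp, hv.neg]; tauto))
      (.basic (.kAs x t _ _))
  have h2 : Derivable Ax (dassign x t top) := .basic (.dAs x t)
  have h3 : Derivable Ax (imp (dassign x t a) (assign x t a)) := .basic (.detAs x t a)
  exact .taut3 h1 h2 h3 fun v hv => by
    simp only [dassign, hv.imp, hv.neg, hv.iff]; tauto

/-- A variable that is only introduced as a name of some term can be eliminated. -/
theorem Derivable.of_eq_imp {y : S.Var} {t : Term S} (hy : y ∉ a.fv)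
    (h : Derivable Ax (imp (eq (.var y) t) a)) : Derivable Ax a := by
  -- Since `[y := t] y ≈ t` is an axiom, `a` holds after assigning `t` to `y`; as `y` is not free in
  -- `a`, that assignment is vacuous.
  have h1 : Derivable Ax (assign y t a) := .mp' (.assign_imp y t h) (.basic (.efAs y t))
  have h2 : Derivable Ax ((neg a).imp (assign y t (neg a))) := .imp_assign_of_notMem t hy
  exact .taut3 h1 h2 (.assign_neg y t a) fun v hv => by
    simp only [hv.imp, hv.neg, hv.iff]; tauto

/-- The axiom `sub2As` is one direction. Its instance for the negation of `a` is the other, because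
assignments commute with negation. -/
theorem Derivable.assign_iff_rename {x y : S.Var} (h : a.Admissible x y) :
    Derivable Ax ((assign x (.var y) a).iff (a.rename x y)) := by
  have h1 : Derivable Ax (imp (a.rename x y) (assign x (.var y) a)) := .basic (.sub2As x y a h)
  have h2 : Derivable Ax (imp (neg (a.rename x y)) (assign x (.var y) (neg a))) :=
    .basic (.sub2As x y (neg a) h)
  exact .taut3 h1 h2 (.assign_neg x _ a) fun v hv => by
    simp only [hv.imp, hv.neg, hv.iff]; tauto

theorem Term.rename_self (x : S.Var) (t : Term S) : t.rename x x = t := by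
  cases t <;> simp +contextual [Term.rename]

theorem Formula.rename_self (x : S.Var) (a : Formula S) : a.rename x x = a := by
  induction a <;> simp_all [rename, Term.rename_self]

theorem Formula.admissible_self (x : S.Var) (a : Formula S) : a.Admissible x x := by
  induction a <;> simp_all [Admissible, or_iff_not_imp_left]

theorem Formula.admissible_of_notMem {x z : S.Var} (a : Formula S) (hz : z ∉ a.vars) :
    a.Admissible x z := by
  induction a <;> simp_all [Admissible, vars, eq_comm]

/-- `[x := x] a` is equivalent to `a`, so `y ≈ x` makes `[x := y] a` equivalent to `a`; the premise
`y ≈ x` is then discharged by `of_eq_imp`. -/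
theorem Derivable.of_assign {x y : S.Var} (hy : y ∉ a.fv) (h : Derivable Ax (assign x (.var y) a)) : Derivable Ax a := by
  refine .of_eq_imp (t := .var x) hy ?_
  have h1 : Derivable Ax (imp (eq (.var y) (.var x)) (iff (assign x (.var y) a) (assign x (.var x) a))) :=
    .basic (.subAs x _ _ a)
  have h2 := Derivable.assign_iff_rename (Ax := Ax) (a.admissible_self x)
  rw [a.rename_self] at h2
  exact .taut3 h h1 h2 fun v hv => by simp only [hv.imp, hv.iff]; tauto

/-! ### Static formulas -/

/-- Formulas without event updates. -/
inductive SFormula (S : Signature.{u}) : Type u where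
  | eq (t t' : Term S) : SFormula S
  | pred (P : S.Pred) (ts : Fin (S.arity P) → Term S) : SFormula S
  | neg (φ : SFormula S) : SFormula S
  | and (φ ψ : SFormula S) : SFormula S
  | know (i : S.Agent) (φ : SFormula S) : SFormula S
  | assign (x : S.Var) (t : Term S) (φ : SFormula S) : SFormula S

namespace SFormula

/-- A static formula as a formula. -/
def toF : SFormula S → Formula S
  | eq t t' => .eq t t'
  | pred P ts => .pred P ts
  | neg φ => .neg φ.toF
  | and φ ψ => .and φ.toF ψ.toF
  | know i φ => .know i φ.toF
  | assign x t φ => .assign x t φ.toF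

/-- Implication of static formulas. -/
def imp (φ ψ : SFormula S) : SFormula S := neg (and φ (neg ψ))

end SFormula

variable (Ax) in
/-- A formula is reducible if it is provably and semantically equivalent to a static formula. -/
def Reducible (φ : Formula S) : Prop :=
  ∃ ψ : SFormula S, Derivable Ax (φ.iff ψ.toF) ∧
    ∀ (M : Model S) (w : M.World) (σ : S.Var → M.Dom), Sat φ M w σ ↔ Sat ψ.toF M w σ

namespace Reducible

theorem sat_imp {M : Model S} {w : M.World} {σ : S.Var → M.Dom} :
    Sat (a.imp b) M w σ ↔ (Sat a M w σ → Sat b M w σ) := by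
  simp only [Formula.imp, Sat]; tauto

theorem of_iff (h : Derivable Ax (a.iff b))
    (hs : ∀ (M : Model S) (w : M.World) (σ : S.Var → M.Dom), Sat a M w σ ↔ Sat b M w σ)
    (hb : Reducible Ax b) : Reducible Ax a := by
  obtain ⟨ψ, h1, h2⟩ := hb
  exact ⟨ψ, h.iff_trans h1, fun M w σ => (hs M w σ).trans (h2 M w σ)⟩

theorem static (ψ : SFormula S) : Reducible Ax ψ.toF :=
  ⟨ψ, .taut fun v hv => by simp only [hv.iff], fun _ _ _ => Iff.rfl⟩

theorem neg (ha : Reducible Ax a) : Reducible Ax (neg a) := by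
  obtain ⟨ψ, h1, h2⟩ := ha
  exact ⟨.neg ψ, .taut1 h1 fun v hv => by simp only [SFormula.toF, hv.iff, hv.neg]; tauto,
    fun M w σ => not_congr (h2 M w σ)⟩

theorem and (ha : Reducible Ax a) (hb : Reducible Ax b) : Reducible Ax (and a b) := by
  obtain ⟨ψ, h1, h2⟩ := ha
  obtain ⟨χ, h3, h4⟩ := hb
  exact ⟨.and ψ χ, .taut2 h1 h3 fun v hv => by simp only [SFormula.toF, hv.iff, hv.and]; tauto,
    fun M w σ => and_congr (h2 M w σ) (h4 M w σ)⟩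

theorem imp (ha : Reducible Ax a) (hb : Reducible Ax b) : Reducible Ax (imp a b) :=
  (ha.and hb.neg).neg

theorem know (i : S.Agent) (ha : Reducible Ax a) : Reducible Ax (know i a) := by
  obtain ⟨ψ, h1, h2⟩ := ha
  exact ⟨.know i ψ, .know_iff i h1, fun M w σ => forall₂_congr fun v _ => h2 M v σ⟩

theorem assign (x : S.Var) (t : Term S) (ha : Reducible Ax a) : Reducible Ax (assign x t a) := by
  obtain ⟨ψ, h1, h2⟩ := ha
  exact ⟨.assign x t ψ, .assign_iff x t h1, fun M w σ => h2 M w _⟩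

theorem top : Reducible Ax (top : Formula S) :=
  .imp (.static (.eq _ _)) (.static (.eq _ _))

theorem conj : ∀ {l : List (Formula S)}, (∀ φ ∈ l, Reducible Ax φ) → Reducible Ax (conj l)
  | [], _ => top
  | φ :: l, h => .and (h φ (by simp)) (conj fun ψ hψ => h ψ (by simp [hψ]))

/-- The static equivalent of `a` may itself contain `z`, so it is not renamed; the equivalent
assignment `[x := z] a` is used instead. -/
theorem rename {x z : S.Var} (hz : z ∉ a.vars) (ha : Reducible Ax a) :
    Reducible Ax (a.rename x z) := by
  refine .of_iff (b := .assign x (.var z) a) ?_ (fun M w σ => ?_) (ha.assign x _)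
  · exact .taut1 (.assign_iff_rename (a.admissible_of_notMem hz))
      fun v hv => by simp only [hv.iff]; tauto
  · rw [sat_rename a hz]
    rfl

end Reducible

/-! ### Elimination of event updates -/

theorem sat_conj {l : List (Formula S)} {M : Model S} {w : M.World} {σ : S.Var → M.Dom} :
    Sat (conj l) M w σ ↔ ∀ φ ∈ l, Sat φ M w σ := by
  induction l with
  | nil => simp [conj, top, Reducible.sat_imp]
  | cons φ l ih => simp [conj, Sat, ih]

theorem Formula.finite_vars (φ : Formula S) : φ.vars.Finite := by
  have ht : ∀ t : Term S, t.vars.Finite := by rintro (x | a) <;> simp [Term.vars]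
  induction φ with
  | eq t t' => exact (ht t).union (ht t')
  | pred P ts => exact Set.finite_iUnion fun k => ht _
  | neg φ ih => exact ih
  | and φ ψ ih1 ih2 => exact ih1.union ih2
  | know i φ ih => exact ih
  | assign x t φ ih => exact ((Set.finite_singleton x).union (ht t)).union ih
  | event F pre e φ ihp ih =>
    have := F.finite
    exact (Set.finite_iUnion ihp).union ih

theorem Term.finite_vars (t : Term S) : t.vars.Finite := by
  cases t <;> simp [Term.vars]

/-- Every formula is reducible, and reducibility is preserved by event updates. -/
theorem reducible_aux (hR : ∀ χ, ReductionAxiom χ → Ax χ) (φ : Formula S) :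
    Reducible Ax φ ∧ ∀ (F : EventFrame S.Agent) (pre : F.Event → Formula S) (e : F.Event),
      (∀ f, Reducible Ax (pre f)) → Reducible Ax (event F pre e φ) := by
  have ax : ∀ {χ}, ReductionAxiom χ → Derivable Ax χ := fun h => .ax _ (hR _ h)
  have atom : ∀ p : SFormula S, p.toF.IsAtomic →
      (∀ (M : Model S) (F : EventFrame S.Agent) (ok : M.World → F.Event → Prop) p' σ,
        Sat p.toF (M.update F ok) p' σ ↔ Sat p.toF M p'.1.1 σ) →
      Reducible Ax p.toF ∧ ∀ (F : EventFrame S.Agent) (pre : F.Event → Formula S) (e : F.Event),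
      (∀ f, Reducible Ax (pre f)) → Reducible Ax (event F pre e p.toF) := by
    refine fun p hp hs => ⟨.static p, fun F pre e hpre => ?_⟩
    refine .of_iff (ax (.uAtom F pre e _ hp)) (fun M w σ => ?_) ((hpre e).imp (.static p))
    rw [Reducible.sat_imp]
    exact forall_congr' fun h => hs _ _ _ _ _
  -- Since the second component covers all event models with reducible preconditions, structural
  -- induction suffices and no complexity measure is needed.
  induction φ with
  | eq t t' =>
    refine atom (.eq t t') (.eq t t') fun M F ok p σ => ?_
    simp only [SFormula.toF, Sat, Term.val_update]
  | pred P ts =>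
    refine atom (.pred P ts) (.pred P ts) fun M F ok p σ => ?_
    simp only [SFormula.toF, Sat, Term.val_update]
  | neg φ ih =>
    refine ⟨ih.1.neg, fun F pre e hpre => ?_⟩
    refine .of_iff (ax (.uNeg F pre e φ)) (fun M w σ => ?_) ((hpre e).imp (ih.2 F pre e hpre).neg)
    rw [Reducible.sat_imp]
    exact ⟨fun h h1 h2 => h h1 (h2 h1), fun h h1 h2 => h h1 fun _ => h2⟩
  | and φ ψ ih1 ih2 =>
    refine ⟨ih1.1.and ih2.1, fun F pre e hpre => ?_⟩
    refine .of_iff (ax (.uCon F pre e φ ψ)) (fun M w σ => ?_)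
      ((ih1.2 F pre e hpre).and (ih2.2 F pre e hpre))
    exact forall_and
  | know i φ ih =>
    refine ⟨ih.1.know i, fun F pre e hpre => ?_⟩
    have := F.finite
    have hl : ∀ f, f ∈ (Set.toFinite {f | F.rel i e f}).toFinset.toList ↔ F.rel i e f := by simp
    refine .of_iff (ax (.uK F pre e i φ _ hl)) (fun M w σ => ?_) ((hpre e).imp (.conj ?_))
    · rw [Reducible.sat_imp, sat_conj]
      constructor
      · intro h h1 ψ hψ
        obtain ⟨f, hf, rfl⟩ := List.mem_map.1 hψ
        exact fun v hv h2 => h h1 ⟨(v, f), h2⟩ ⟨hv, (hl f).1 hf⟩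
      · rintro h h1 ⟨⟨v, f⟩, h2⟩ ⟨hv, hf⟩
        exact h h1 (.know i (.event F pre f φ)) (List.mem_map.2 ⟨f, (hl f).2 hf, rfl⟩) v hv h2
    · intro χ hχ
      obtain ⟨f, -, rfl⟩ := List.mem_map.1 hχ
      exact (ih.2 F pre f hpre).know i
  | assign x t φ ih =>
    refine ⟨ih.1.assign x t, fun F pre e hpre => ?_⟩
    have := F.finite
    obtain ⟨z, hz⟩ := ((φ.finite_vars.union t.finite_vars).union
      (Set.finite_iUnion fun f => (pre f).finite_vars)).exists_notMem
    simp only [Set.mem_union, Set.mem_iUnion, not_or, not_exists] at hz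
    obtain ⟨⟨h1, h2⟩, h3⟩ := hz
    exact .of_iff (ax (.uAssi F pre e x z t φ h1 h2 h3))
      (fun M w σ => sat_event_assign h1 h2 h3)
      (((ih.2 F _ e fun f => (hpre f).rename (h3 f)).assign x t).assign z _)
  | event G pre' e' φ ihp ih =>
    refine ⟨ih.2 G pre' e' fun f => (ihp f).1, fun F pre e hpre => ?_⟩
    -- The composed event model is larger, but the hypothesis for `φ` covers it once its
    -- preconditions are reducible, which the hypotheses for `pre'` ensure.
    exact .of_iff (ax (.uCom F G pre pre' e e' φ)) (fun M w σ => sat_comp)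
      (ih.2 (F.comp G) _ _ fun p => (hpre p.1).and ((ihp p.2).2 F pre p.1 hpre))

end DELAS

namespace DELAS

variable {S : Signature.{u}}


/-! ### Maximal consistent sets of static formulas -/

/-- Consequence by modus ponens from theorems and the formulas in a set. -/
inductive Entails (Ax : Formula S → Prop) (Γ : Set (SFormula S)) : SFormula S → Prop where
  | mem {a : SFormula S} (h : a ∈ Γ) : Entails Ax Γ a
  | thm {a : SFormula S} (h : Derivable Ax a.toF) : Entails Ax Γ a
  | mp {a b : SFormula S} (h : Entails Ax Γ (a.imp b)) (h' : Entails Ax Γ a) : Entails Ax Γ b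

/-- Maximal consistent sets of static formulas. -/
structure MaxCons (Ax : Formula S → Prop) (Δ : Set (SFormula S)) : Prop where
  closed : ∀ {a : SFormula S}, Entails Ax Δ a → a ∈ Δ
  neg_mem : ∀ {a : SFormula S}, .neg a ∈ Δ ↔ a ∉ Δ

variable [Infinite S.Var] {Ax : Formula S → Prop} [Basic Ax]

namespace SFormula

/-- A contradiction. -/
noncomputable def bot : SFormula S :=
  and (eq (.var (Classical.arbitrary _)) (.var (Classical.arbitrary _)))
    (neg (eq (.var (Classical.arbitrary _)) (.var (Classical.arbitrary _))))

end SFormula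

open SFormula

variable {a b c : SFormula S} {Γ Δ : Set (SFormula S)}

theorem Respects.bot {v : Formula S → Prop} (hv : Respects v) :
    ¬ v (bot : SFormula S).toF := by
  simp [SFormula.bot, toF, hv.and, hv.neg]

theorem Respects.toF_imp {v : Formula S → Prop} (hv : Respects v) :
    v (a.imp b).toF ↔ (v a.toF → v b.toF) :=
  hv.imp _ _

namespace Entails

theorem taut1 (h : Entails Ax Γ a) (hv : ∀ v, Respects v → v a.toF → v b.toF) :
    Entails Ax Γ b :=
  .mp (.thm (.taut fun v h => h.toF_imp.2 (hv v h))) h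

theorem taut2 (h : Entails Ax Γ a) (h' : Entails Ax Γ b)
    (hv : ∀ v, Respects v → v a.toF → v b.toF → v c.toF) : Entails Ax Γ c :=
  .mp (.taut1 h fun v hr ha => hr.toF_imp.2 (hv v hr ha)) h'

theorem mono (hΓ : Γ ⊆ Δ) (h : Entails Ax Γ a) : Entails Ax Δ a := by
  induction h with
  | mem h => exact .mem (hΓ h)
  | thm h => exact .thm h
  | mp _ _ ih1 ih2 => exact .mp ih1 ih2

/-- Necessitation applies to theorems only, never to members of the set, so modus ponens is the only
rule to treat. -/
theorem deduction (h : Entails Ax (insert a Γ) b) : Entails Ax Γ (a.imp b) := by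
  induction h with
  | mem h =>
    rcases h with rfl | h
    · exact .thm (.taut fun v hv => hv.toF_imp.2 id)
    · exact .taut1 (.mem h) fun v hv h => hv.toF_imp.2 fun _ => h
  | thm h => exact .taut1 (.thm h) fun v hv h => hv.toF_imp.2 fun _ => h
  | mp _ _ ih1 ih2 =>
    refine .taut2 ih1 ih2 fun v hv => ?_
    simp only [hv.toF_imp]; tauto

theorem of_sUnion {C : Set (Set (SFormula S))} (hC : IsChain (· ⊆ ·) C) (hne : C.Nonempty)
    (h : Entails Ax (⋃₀ C) a) : ∃ Γ ∈ C, Entails Ax Γ a := by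
  induction h with
  | mem h =>
    obtain ⟨Γ, hΓ, h⟩ := h
    exact ⟨Γ, hΓ, .mem h⟩
  | thm h => exact hne.imp fun Γ hΓ => ⟨hΓ, .thm h⟩
  | mp _ _ ih1 ih2 =>
    obtain ⟨Γ, hΓ, h1⟩ := ih1
    obtain ⟨Γ', hΓ', h2⟩ := ih2
    rcases hC.total hΓ hΓ' with h | h
    · exact ⟨Γ', hΓ', .mp (h1.mono h) h2⟩
    · exact ⟨Γ, hΓ, .mp h1 (h2.mono h)⟩

/-- Consequences of a set closed under conjunction follow from a single formula of the set. -/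
theorem exists_imp (hne : Γ.Nonempty) (hand : ∀ a ∈ Γ, ∀ b ∈ Γ, a.and b ∈ Γ)
    (h : Entails Ax Γ a) : ∃ c ∈ Γ, Derivable Ax (c.imp a).toF := by
  induction h with
  | mem h => exact ⟨_, h, .taut fun v hv => hv.toF_imp.2 id⟩
  | thm h => exact hne.imp fun c hc => ⟨hc, .taut1 h fun v hv h => hv.toF_imp.2 fun _ => h⟩
  | mp _ _ ih1 ih2 =>
    obtain ⟨c, hc, h1⟩ := ih1
    obtain ⟨d, hd, h2⟩ := ih2
    refine ⟨_, hand c hc d hd, .taut2 h1 h2 fun v hv => ?_⟩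
    simp only [hv.toF_imp, toF, hv.and]; tauto

end Entails

/-- Lindenbaum's lemma. -/
theorem exists_maxCons (h : ¬ Entails Ax Γ bot) : ∃ Δ, Γ ⊆ Δ ∧ MaxCons Ax Δ := by
  obtain ⟨Δ, hΔ, hmax⟩ := zorn_subset_nonempty {Δ | ¬ Entails Ax Δ (bot : SFormula S)}
    (fun C hC hch hne => ⟨⋃₀ C, fun hb => by
      obtain ⟨Γ, hΓ, h⟩ := hb.of_sUnion hch hne
      exact hC hΓ h, fun Γ hΓ => Set.subset_sUnion_of_mem hΓ⟩) Γ h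
  have hins : ∀ {a}, a ∉ Δ → Entails Ax Δ (a.imp bot) := by
    intro a ha
    by_contra hb
    exact ha (hmax.2 (y := insert a Δ) (fun h => hb h.deduction) (Set.subset_insert _ _)
      (Set.mem_insert _ _))
  have hcl : ∀ {a}, Entails Ax Δ a → a ∈ Δ := by
    intro a ha
    by_contra hb
    exact hmax.1 (.mp (hins hb) ha)
  refine ⟨Δ, hΔ, hcl, fun {a} => ⟨fun h1 h2 => ?_, fun h => ?_⟩⟩
  · refine hmax.1 (.taut2 (.mem h1) (.mem h2) fun v hv => ?_)
    simp only [toF, hv.neg]; tauto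
  · refine hcl (.taut1 (hins h) fun v hv => ?_)
    have := hv.bot
    simp only [toF, hv.neg, hv.toF_imp]; tauto

namespace MaxCons

variable (h : MaxCons Ax Δ)
include h

theorem thm (ha : Derivable Ax a.toF) : a ∈ Δ := h.closed (.thm ha)

theorem mp (hab : Derivable Ax (a.imp b).toF) (ha : a ∈ Δ) : b ∈ Δ := h.closed (.mp (.thm hab) (.mem ha))

theorem iff (hab : Derivable Ax (a.toF.iff b.toF)) : a ∈ Δ ↔ b ∈ Δ :=
  ⟨h.mp hab.iff_left, h.mp hab.iff_right⟩

theorem and_mem : and a b ∈ Δ ↔ a ∈ Δ ∧ b ∈ Δ := by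
  constructor
  · refine fun hab => ⟨h.closed (.taut1 (.mem hab) fun v hv => ?_),
      h.closed (.taut1 (.mem hab) fun v hv => ?_)⟩ <;> simp only [toF, hv.and] <;> tauto
  · refine fun ⟨ha, hb⟩ => h.closed (.taut2 (.mem ha) (.mem hb) fun v hv => ?_)
    simp only [toF, hv.and]; tauto

theorem imp_mem : a.imp b ∈ Δ ↔ (a ∈ Δ → b ∈ Δ) := by
  rw [SFormula.imp, h.neg_mem, h.and_mem, h.neg_mem]; tauto

theorem bot_notMem : bot ∉ Δ := by
  rw [SFormula.bot, h.and_mem, h.neg_mem]; tauto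

theorem know_of_entails {i : S.Agent} {Γ : Set (SFormula S)} (hΓ : ∀ b ∈ Γ, know i b ∈ Δ)
    (ha : Entails Ax Γ a) : know i a ∈ Δ := by
  induction ha with
  | mem ha => exact hΓ _ ha
  | thm ha => exact h.thm (a := know i _) (.necK i _ ha)
  | @mp a b _ _ ih1 ih2 =>
    have h1 : (know i (a.imp b)).imp ((know i a).imp (know i b)) ∈ Δ :=
      h.thm (.basic (.distK i a.toF b.toF))
    exact h.imp_mem.1 (h.imp_mem.1 h1 ih1) ih2

theorem eq_refl (t : Term S) : eq t t ∈ Δ := h.thm (.basic (.id t))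

theorem eq_comm {t t' : Term S} : eq t t' ∈ Δ ↔ eq t' t ∈ Δ := h.iff (.basic (.sym t t'))

theorem eq_trans {t t' t'' : Term S} (h1 : eq t t' ∈ Δ) (h2 : eq t' t'' ∈ Δ) : eq t t'' ∈ Δ :=
  h.mp (a := and (eq t t') (eq t' t'')) (.basic (.trans t t' t'')) (h.and_mem.2 ⟨h1, h2⟩)

theorem eq_congr {t t' s s' : Term S} (h1 : eq t s ∈ Δ) (h2 : eq t' s' ∈ Δ) :
    eq t t' ∈ Δ ↔ eq s s' ∈ Δ :=
  ⟨fun e => h.eq_trans (h.eq_comm.1 h1) (h.eq_trans e h2),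
    fun e => h.eq_trans h1 (h.eq_trans e (h.eq_comm.1 h2))⟩

theorem pred_congr {P : S.Pred} {ts ts' : Fin (S.arity P) → Term S}
    (ht : ∀ k, eq (ts k) (ts' k) ∈ Δ) : pred P ts ∈ Δ ↔ pred P ts' ∈ Δ := by
  -- The axiom `subP` has a conjunction of `Formula`s as premise; a static formula in `Δ` with that
  -- translation is needed.
  have key : ∀ l : List (Term S × Term S), (∀ p ∈ l, eq p.1 p.2 ∈ Δ) →
      ∃ c ∈ Δ, c.toF = Formula.conj (l.map fun p => .eq p.1 p.2) := by
    intro l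
    induction l with
    | nil =>
      refine fun _ => ⟨SFormula.imp (eq _ _) (eq _ _), h.imp_mem.2 id, rfl⟩
    | cons p l ih =>
      intro hl
      obtain ⟨c, hc, e⟩ := ih fun q hq => hl q (by simp [hq])
      refine ⟨and (eq p.1 p.2) c, h.and_mem.2 ⟨hl p (by simp), hc⟩, ?_⟩
      simp [toF, e, Formula.conj]
  obtain ⟨c, hc, e⟩ := key (List.ofFn fun k => (ts k, ts' k)) (by
    intro p hp
    obtain ⟨k, rfl⟩ := (List.mem_ofFn' _ _).1 hp
    exact ht k)
  have hax : Derivable Ax (c.toF.imp (((pred P ts).toF).iff (pred P ts').toF)) := by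
    rw [e, List.map_ofFn]
    exact .basic (.subP P ts ts')
  have h1 : Derivable Ax (c.imp ((pred P ts).imp (pred P ts'))).toF := .taut1 hax fun v hv => by
    simp only [hv.toF_imp, hv.imp, hv.iff]; tauto
  have h2 : Derivable Ax (c.imp ((pred P ts').imp (pred P ts))).toF := .taut1 hax fun v hv => by
    simp only [hv.toF_imp, hv.imp, hv.iff]; tauto
  exact ⟨h.imp_mem.1 (h.mp h1 hc), h.imp_mem.1 (h.mp h2 hc)⟩

theorem assign_congr {x : S.Var} {t t' : Term S} (ht : eq t t' ∈ Δ) :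
    assign x t a ∈ Δ ↔ assign x t' a ∈ Δ := by
  have hax : Derivable Ax (((eq t t').toF).imp ((assign x t a).toF.iff (assign x t' a).toF)) :=
    .basic (.subAs x t t' a.toF)
  have h1 : Derivable Ax ((eq t t').imp ((assign x t a).imp (assign x t' a))).toF := .taut1 hax fun v hv => by
    simp only [hv.toF_imp, hv.imp, hv.iff]; tauto
  have h2 : Derivable Ax ((eq t t').imp ((assign x t' a).imp (assign x t a))).toF := .taut1 hax fun v hv => by
    simp only [hv.toF_imp, hv.imp, hv.iff]; tauto
  exact ⟨h.imp_mem.1 (h.mp h1 ht), h.imp_mem.1 (h.mp h2 ht)⟩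

theorem know_eq {i : S.Agent} {x y : S.Var} (hxy : eq (.var x) (.var y) ∈ Δ) :
    know i (eq (.var x) (.var y)) ∈ Δ :=
  h.mp (a := eq (.var x) (.var y)) (.basic (.rigidP i x y)) hxy

theorem know_ne {i : S.Agent} {x y : S.Var} (hxy : eq (.var x) (.var y) ∉ Δ) :
    know i (neg (eq (.var x) (.var y))) ∈ Δ :=
  h.mp (a := neg (eq (.var x) (.var y))) (.basic (.rigidN i x y)) (h.neg_mem.2 hxy)

/-- The formulas known in a maximal consistent set are consistent with every formula the negation
of which is not known. -/
theorem exists_of_know_notMem {i : S.Agent} (ha : know i a ∉ Δ) :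
    ∃ Θ, MaxCons Ax Θ ∧ (∀ b, know i b ∈ Δ → b ∈ Θ) ∧ a ∉ Θ := by
  have hc : ¬ Entails Ax (insert (neg a) {b | know i b ∈ Δ}) bot := by
    intro hb
    refine ha (h.know_of_entails (fun b hb => hb) (.taut1 hb.deduction fun v hv => ?_))
    have := hv.bot
    simp only [toF, hv.neg, hv.toF_imp]; tauto
  obtain ⟨Θ, h1, h2⟩ := exists_maxCons hc
  exact ⟨Θ, h2, fun b hb => h1 (Or.inr hb), h2.neg_mem.1 (h1 (Or.inl rfl))⟩

end MaxCons

/-! ### Substitution of variables -/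

/-- The term `t` with every variable replaced according to `τ`. -/
def Term.sub (τ : S.Var → S.Var) : Term S → Term S
  | .var x => .var (τ x)
  | .name a => .name a

namespace SFormula

open Classical in
/-- Replacement of the free variables according to `τ`. -/
noncomputable def sub (τ : S.Var → S.Var) : SFormula S → SFormula S
  | eq t t' => eq (t.sub τ) (t'.sub τ)
  | pred P ts => pred P (fun k => (ts k).sub τ)
  | neg φ => neg (φ.sub τ)
  | and φ ψ => and (φ.sub τ) (ψ.sub τ)
  | know i φ => know i (φ.sub τ)
  | assign x t φ => assign x (t.sub τ) (φ.sub (Function.update τ x x))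

/-- The bound variables. -/
def bv : SFormula S → Set S.Var
  | eq _ _ => ∅
  | pred _ _ => ∅
  | neg φ => φ.bv
  | and φ ψ => φ.bv ∪ ψ.bv
  | know _ φ => φ.bv
  | assign x _ φ => insert x φ.bv

/-- The free variables. -/
abbrev fv (φ : SFormula S) : Set S.Var := φ.toF.fv

end SFormula

theorem Term.sub_eq_self {τ : S.Var → S.Var} {t : Term S} (h : ∀ x ∈ t.vars, τ x = x) :
    t.sub τ = t := by
  cases t with
  | var x => exact congrArg _ (h x rfl)
  | name a => rfl

theorem Term.vars_sub {τ : S.Var → S.Var} {t : Term S} : (t.sub τ).vars = τ '' t.vars := by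
  cases t <;> simp [Term.sub, Term.vars]

theorem SFormula.sub_eq_self (φ : SFormula S) : ∀ {τ : S.Var → S.Var}, (∀ x ∈ φ.fv, τ x = x) →
    φ.sub τ = φ := by
  induction φ with
  | eq t t' =>
    intro τ h
    rw [SFormula.sub, Term.sub_eq_self fun x hx => h x (Or.inl hx),
      Term.sub_eq_self fun x hx => h x (Or.inr hx)]
  | pred P ts =>
    intro τ h
    rw [SFormula.sub]
    congr
    funext k
    exact Term.sub_eq_self fun x hx => h x (Set.mem_iUnion.2 ⟨k, hx⟩)
  | neg φ ih => intro τ h; rw [SFormula.sub, ih h]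
  | and φ ψ ih1 ih2 =>
    intro τ h
    rw [SFormula.sub, ih1 fun x hx => h x (Or.inl hx), ih2 fun x hx => h x (Or.inr hx)]
  | know i φ ih => intro τ h; rw [SFormula.sub, ih h]
  | assign y t φ ih =>
    intro τ h
    rw [SFormula.sub, Term.sub_eq_self fun x hx => h x (Or.inr hx), ih fun x hx => ?_]
    by_cases hxy : x = y
    · subst hxy; simp
    · simpa [hxy] using h x (Or.inl ⟨hx, hxy⟩)

theorem SFormula.fv_sub (φ : SFormula S) : ∀ {τ : S.Var → S.Var} {U : Set S.Var},
    (∀ x ∈ φ.fv, τ x ∈ U) → (φ.sub τ).fv ⊆ U := by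
  induction φ with
  | eq t t' =>
    rintro τ U h x (hx | hx) <;> rw [Term.vars_sub] at hx <;> obtain ⟨y, hy, rfl⟩ := hx
    · exact h y (Or.inl hy)
    · exact h y (Or.inr hy)
  | pred P ts =>
    intro τ U h x hx
    obtain ⟨k, hx⟩ := Set.mem_iUnion.1 hx
    rw [Term.vars_sub] at hx
    obtain ⟨y, hy, rfl⟩ := hx
    exact h y (Set.mem_iUnion.2 ⟨k, hy⟩)
  | neg φ ih => intro τ U h; exact ih h
  | and φ ψ ih1 ih2 =>
    intro τ U h
    exact Set.union_subset (ih1 fun x hx => h x (Or.inl hx)) (ih2 fun x hx => h x (Or.inr hx))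
  | know i φ ih => intro τ U h; exact ih h
  | assign y t φ ih =>
    rintro τ U h x (⟨hx, hxy⟩ | hx)
    · have : x ∈ insert y U := by
        refine ih (fun z hz => ?_) hx
        by_cases hzy : z = y
        · subst hzy; simp
        · simpa [hzy] using Or.inr (h z (Or.inl ⟨hz, hzy⟩))
      exact this.resolve_left hxy
    · rw [Term.vars_sub] at hx
      obtain ⟨z, hz, rfl⟩ := hx
      exact h z (Or.inr hz)

open Classical in
theorem Term.rename_sub {τ : S.Var → S.Var} {z y : S.Var} (hτ : ∀ x, x ≠ z → τ x ≠ z)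
    (t : Term S) : (t.sub (Function.update τ z z)).rename z y = t.sub (Function.update τ z y) := by
  cases t with
  | var x =>
    by_cases hx : x = z
    · subst hx; simp [Term.sub, Term.rename]
    · simp [Term.sub, Term.rename, hx, hτ x hx]
  | name a => rfl

open Classical in
-- As `τ` sends no other variable to `z`, the free `z` left by the inner substitution are exactly
-- those that come from `z`. The condition survives passing under a binder.
theorem SFormula.rename_sub {z y : S.Var} (φ : SFormula S) : ∀ {τ : S.Var → S.Var},
    (∀ x, x ≠ z → τ x ≠ z) →
    (φ.sub (Function.update τ z z)).toF.rename z y = (φ.sub (Function.update τ z y)).toF := by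
  induction φ with
  | eq t t' => intro τ h; simp only [SFormula.sub, toF, Formula.rename, Term.rename_sub h]
  | pred P ts => intro τ h; simp only [SFormula.sub, toF, Formula.rename, Term.rename_sub h]
  | neg φ ih => intro τ h; simp only [SFormula.sub, toF, Formula.rename, ih h]
  | and φ ψ ih1 ih2 => intro τ h; simp only [SFormula.sub, toF, Formula.rename, ih1 h, ih2 h]
  | know i φ ih => intro τ h; simp only [SFormula.sub, toF, Formula.rename, ih h]
  | assign x t φ ih =>
    intro τ h
    simp only [SFormula.sub, toF, Formula.rename, Term.rename_sub h]
    split_ifs with hx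
    · subst hx; simp
    · rw [Function.update_comm (Ne.symm hx), Function.update_comm (Ne.symm hx), ih]
      intro v hv
      by_cases hvx : v = x
      · subst hvx; simpa using hx
      · simpa [hvx] using h v hv

theorem SFormula.admissible_sub {z y : S.Var} (φ : SFormula S) : ∀ {τ : S.Var → S.Var},
    y ∉ φ.bv → (φ.sub τ).toF.Admissible z y := by
  induction φ with
  | eq t t' => intro τ h; trivial
  | pred P ts => intro τ h; trivial
  | neg φ ih => intro τ h; exact ih h
  | and φ ψ ih1 ih2 => intro τ h; exact ⟨ih1 fun e => h (Or.inl e), ih2 fun e => h (Or.inr e)⟩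
  | know i φ ih => intro τ h; exact ih h
  | assign x t φ ih =>
    intro τ h
    exact Or.inr ⟨ih fun e => h (Or.inr e), fun e => absurd (Or.inl e.symm) h⟩

open Classical in
/-- An assignment of a variable amounts to a substitution. -/
theorem MaxCons.assign_sub_iff (h : MaxCons Ax Δ) {τ : S.Var → S.Var} {z y : S.Var}
    (hτ : ∀ x, τ x ≠ z) (hy : y ∉ a.bv) :
    assign z (.var y) (a.sub (Function.update τ z z)) ∈ Δ ↔ a.sub (Function.update τ z y) ∈ Δ := by
  refine h.iff ?_
  rw [← SFormula.rename_sub a fun x _ => hτ x]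
  exact .assign_iff_rename (a.admissible_sub hy)

end DELAS

namespace DELAS

variable {S : Signature.{u}}

/-! ### Canonical structures -/

/-- Sets of variables, names, agents, and predicate symbols. -/
structure Vocabulary (S : Signature.{u}) where
  vars : Set S.Var
  names : Set S.Name
  agents : Set S.Agent
  preds : Set S.Pred

/-- The terms over a vocabulary. -/
def Term.Over (V : Vocabulary S) : Term S → Prop
  | .var x => x ∈ V.vars
  | .name a => a ∈ V.names

/-- The static formulas over a vocabulary. -/
def SFormula.Over (V : Vocabulary S) : SFormula S → Prop
  | eq t t' => t.Over V ∧ t'.Over V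
  | pred P ts => P ∈ V.preds ∧ ∀ k, (ts k).Over V
  | neg φ => φ.Over V
  | and φ ψ => φ.Over V ∧ ψ.Over V
  | know i φ => i ∈ V.agents ∧ φ.Over V
  | assign x t φ => x ∈ V.vars ∧ t.Over V ∧ φ.Over V

theorem Term.Over.sub {V : Vocabulary S} {τ : S.Var → S.Var} (hτ : ∀ x ∈ V.vars, τ x ∈ V.vars)
    {t : Term S} (h : t.Over V) : (t.sub τ).Over V := by
  cases t with
  | var x => exact hτ x h
  | name a => exact h

theorem SFormula.Over.sub {V : Vocabulary S} {φ : SFormula S} : ∀ {τ : S.Var → S.Var},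
    (∀ x ∈ V.vars, τ x ∈ V.vars) → φ.Over V → (φ.sub τ).Over V := by
  induction φ with
  | eq t t' => intro τ hτ h; exact ⟨h.1.sub hτ, h.2.sub hτ⟩
  | pred P ts => intro τ hτ h; exact ⟨h.1, fun k => (h.2 k).sub hτ⟩
  | neg φ ih => intro τ hτ h; exact ih hτ h
  | and φ ψ ih1 ih2 => intro τ hτ h; exact ⟨ih1 hτ h.1, ih2 hτ h.2⟩
  | know i φ ih => intro τ hτ h; exact ⟨h.1, ih hτ h.2⟩
  | assign x t φ ih =>
    intro τ hτ h
    refine ⟨h.1, h.2.1.sub hτ, ih (fun y hy => ?_) h.2.2⟩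
    by_cases hyx : y = x
    · subst hyx; simpa using hy
    · simpa [hyx] using hτ y hy

variable (S) in
/-- The ingredients of a canonical model: worlds with a theory and a set of parameters, and objects
denoted by the parameters. Parameters are never bound by the formulas under consideration, whose
bound variables lie in `B`. -/
structure Canonical (Ax : Formula S → Prop) (V : Vocabulary S) (B : Set S.Var) where
  World : Type u
  Dom : Type u
  rel : S.Agent → World → World → Prop
  theory : World → Set (SFormula S)
  par : World → Set S.Var
  den : S.Var → Dom
  maxCons : ∀ w, MaxCons Ax (theory w)
  par_over : ∀ w, ∀ x ∈ par w, x ∈ V.vars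
  par_notMem : ∀ w, ∀ x ∈ par w, x ∉ B
  eq_iff : ∀ w, ∀ x ∈ par w, ∀ y ∈ par w, .eq (.var x) (.var y) ∈ theory w ↔ den x = den y
  witness : ∀ w, ∀ a ∈ V.names, ∃ y ∈ par w, .eq (.name a) (.var y) ∈ theory w
  -- Known formulas need to persist only if their free variables are parameters. This admits both
  -- growing parameter sets and a constant one.
  par_mono : ∀ {i w v}, rel i w v → par w ⊆ par v
  know : ∀ {i w v φ}, rel i w v → φ.fv ⊆ par w → .know i φ ∈ theory w → φ ∈ theory v
  exists_rel : ∀ {i w φ}, i ∈ V.agents → φ.Over V → φ.fv ⊆ par w → .know i φ ∉ theory w →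
    ∃ v, rel i w v ∧ φ ∉ theory v

namespace Canonical

variable [Infinite S.Var] {Ax : Formula S → Prop} [Basic Ax] {V : Vocabulary S} {B : Set S.Var}
  (C : Canonical S Ax V B)

open Classical in
/-- The canonical model. -/
noncomputable def model : Model S where
  World := C.World
  Dom := C.Dom
  rel := C.rel
  rho P w := {d | ∃ y : Fin (S.arity P) → S.Var, (∀ k, y k ∈ C.par w) ∧
    (∀ k, d k = C.den (y k)) ∧ .pred P (fun k => .var (y k)) ∈ C.theory w}
  -- Names outside the vocabulary get an arbitrary value, since the formulas considered never
  -- mention them.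
  eta a w := if h : a ∈ V.names then C.den (C.witness w a h).choose
    else C.den (Classical.arbitrary _)

variable {C}

theorem exists_par {w : C.World} {τ : S.Var → S.Var} (hτ : ∀ x, τ x ∈ C.par w) {t : Term S}
    (ht : t.Over V) : ∃ y ∈ C.par w, t.val C.model w (C.den ∘ τ) = C.den y ∧
      .eq (t.sub τ) (.var y) ∈ C.theory w := by
  cases t with
  | var x => exact ⟨τ x, hτ x, rfl, (C.maxCons w).eq_refl _⟩
  | name a =>
    have h := (C.witness w a ht).choose_spec
    exact ⟨_, h.1, dif_pos ht, h.2⟩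

open Classical in
/-- The truth lemma. -/
theorem sat_iff (φ : SFormula S) : ∀ {w : C.World} {τ : S.Var → S.Var},
    φ.Over V → φ.bv ⊆ B → (∀ x, τ x ∈ C.par w) →
    (Sat φ.toF C.model w (C.den ∘ τ) ↔ φ.sub τ ∈ C.theory w) := by
  induction φ with
  | eq t t' =>
    intro w τ hφ hB hτ
    obtain ⟨y, hy, h1, h2⟩ := exists_par hτ hφ.1
    obtain ⟨y', hy', h1', h2'⟩ := exists_par hτ hφ.2
    rw [SFormula.sub, (C.maxCons w).eq_congr h2 h2', C.eq_iff w y hy y' hy', ← h1, ← h1']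
    rfl
  | pred P ts =>
    intro w τ hφ hB hτ
    choose y hy h1 h2 using fun k => exists_par hτ (hφ.2 k)
    rw [SFormula.sub, (C.maxCons w).pred_congr h2]
    change (∃ z : Fin (S.arity P) → S.Var, (∀ k, z k ∈ C.par w) ∧
      (∀ k, (ts k).val C.model w (C.den ∘ τ) = C.den (z k)) ∧
      .pred P (fun k => .var (z k)) ∈ C.theory w) ↔ _
    constructor
    · rintro ⟨z, hz, h3, h4⟩
      refine ((C.maxCons w).pred_congr fun k => ?_).1 h4
      rw [C.eq_iff w _ (hz k) _ (hy k), ← h1, ← h3]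
    · exact fun h => ⟨y, hy, h1, h⟩
  | neg φ ih =>
    intro w τ hφ hB hτ
    exact (not_congr (ih hφ hB hτ)).trans (C.maxCons w).neg_mem.symm
  | and φ ψ ih1 ih2 =>
    intro w τ hφ hB hτ
    exact (and_congr (ih1 hφ.1 (fun x hx => hB (Or.inl hx)) hτ)
      (ih2 hφ.2 (fun x hx => hB (Or.inr hx)) hτ)).trans (C.maxCons w).and_mem.symm
  | know i φ ih =>
    intro w τ hφ hB hτ
    have hfv : (φ.sub τ).fv ⊆ C.par w := φ.fv_sub fun x _ => hτ x
    constructor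
    · intro h
      by_contra hn
      obtain ⟨v, hv, hn⟩ := C.exists_rel hφ.1
        (hφ.2.sub fun x _ => C.par_over w _ (hτ x)) hfv hn
      exact hn ((ih hφ.2 hB fun x => C.par_mono hv (hτ x)).1 (h v hv))
    · exact fun h v hv => (ih hφ.2 hB fun x => C.par_mono hv (hτ x)).2 (C.know hv hfv h)
  | assign z t φ ih =>
    intro w τ hφ hB hτ
    -- The term is replaced by a parameter `y` with the same denotation. Since `z` lies outside the
    -- range of `τ` and `y` is not bound in `φ`, assigning `y` to `z` is a substitution.
    obtain ⟨y, hy, h1, h2⟩ := exists_par hτ hφ.2.1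
    have hz : z ∈ B := hB (Or.inl rfl)
    rw [SFormula.sub, (C.maxCons w).assign_congr h2,
      (C.maxCons w).assign_sub_iff (fun x hx => C.par_notMem w _ (hτ x) (by rwa [hx]))
        (fun hb => C.par_notMem w _ hy (hB (Or.inr hb))),
      ← ih hφ.2.2 (fun x hx => hB (Or.inr hx)) fun x => ?_]
    · change Sat φ.toF C.model w (Function.update (C.den ∘ τ) z _) ↔ _
      rw [h1]
      exact Iff.of_eq (congrArg (Sat φ.toF C.model w) (Function.comp_update ..).symm)
    · by_cases hxz : x = z
      · subst hxz; simpa using hy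
      · simpa [hxz] using hτ x

open Classical in
/-- A formula whose parameters are available at a world is true there iff it belongs to the theory
of that world. -/
theorem exists_sat_iff {φ : SFormula S} {w : C.World} (hφ : φ.Over V) (hB : φ.bv ⊆ B)
    (hfv : φ.fv ⊆ C.par w) (hne : (C.par w).Nonempty) :
    ∃ σ, Sat φ.toF C.model w σ ↔ φ ∈ C.theory w := by
  obtain ⟨u, hu⟩ := hne
  -- The truth lemma needs every variable sent to a parameter; those not free in `φ` go to an
  -- arbitrary one, `u`.
  refine ⟨C.den ∘ fun x => if x ∈ φ.fv then x else u, ?_⟩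
  rw [sat_iff φ hφ hB, φ.sub_eq_self]
  · intro x hx; simp [hx]
  · intro x
    split_ifs with hx
    · exact hfv hx
    · exact hu

end Canonical

/-! ### Finite vocabularies -/

theorem Term.Over.mono {V V' : Vocabulary S} (h1 : V.vars ⊆ V'.vars) (h2 : V.names ⊆ V'.names)
    {t : Term S} (h : t.Over V) : t.Over V' := by
  cases t with
  | var x => exact h1 h
  | name a => exact h2 h

instance : Max (Vocabulary S) where
  max V V' := ⟨V.vars ∪ V'.vars, V.names ∪ V'.names, V.agents ∪ V'.agents, V.preds ∪ V'.preds⟩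

instance : LE (Vocabulary S) where
  le V V' := V.vars ⊆ V'.vars ∧ V.names ⊆ V'.names ∧ V.agents ⊆ V'.agents ∧ V.preds ⊆ V'.preds

theorem SFormula.Over.mono {V V' : Vocabulary S} (h : V ≤ V') {φ : SFormula S} :
    φ.Over V → φ.Over V' := by
  obtain ⟨h1, h2, h3, h4⟩ := h
  induction φ with
  | eq t t' => exact fun h => ⟨h.1.mono h1 h2, h.2.mono h1 h2⟩
  | pred P ts => exact fun h => ⟨h4 h.1, fun k => (h.2 k).mono h1 h2⟩
  | neg φ ih => exact ih
  | and φ ψ ih1 ih2 => exact fun h => ⟨ih1 h.1, ih2 h.2⟩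
  | know i φ ih => exact fun h => ⟨h3 h.1, ih h.2⟩
  | assign x t φ ih => exact fun h => ⟨h1 h.1, h.2.1.mono h1 h2, ih h.2.2⟩

/-- Vocabularies with finitely many symbols. -/
def Vocabulary.Finite (V : Vocabulary S) : Prop :=
  V.vars.Finite ∧ V.names.Finite ∧ V.agents.Finite ∧ V.preds.Finite

theorem Vocabulary.Finite.sup {V V' : Vocabulary S} (h : V.Finite) (h' : V'.Finite) :
    (max V V').Finite :=
  ⟨h.1.union h'.1, h.2.1.union h'.2.1, h.2.2.1.union h'.2.2.1, h.2.2.2.union h'.2.2.2⟩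

theorem Vocabulary.le_max_left (V V' : Vocabulary S) : V ≤ max V V' :=
  ⟨Set.subset_union_left, Set.subset_union_left, Set.subset_union_left, Set.subset_union_left⟩

theorem Vocabulary.le_max_right (V V' : Vocabulary S) : V' ≤ max V V' :=
  ⟨Set.subset_union_right, Set.subset_union_right, Set.subset_union_right, Set.subset_union_right⟩

/-- Every static formula is a formula over some finite vocabulary. -/
theorem SFormula.exists_over (φ : SFormula S) : ∃ V : Vocabulary S, V.Finite ∧ φ.Over V := by
  have ht : ∀ t : Term S, ∃ X : Set S.Var, ∃ N : Set S.Name, X.Finite ∧ N.Finite ∧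
      ∀ A P, t.Over ⟨X, N, A, P⟩ := by
    rintro (x | a)
    · exact ⟨{x}, ∅, by simp, by simp, fun _ _ => rfl⟩
    · exact ⟨∅, {a}, by simp, by simp, fun _ _ => rfl⟩
  choose X N hX hN hO using ht
  induction φ with
  | eq t t' =>
    refine ⟨⟨X t ∪ X t', N t ∪ N t', ∅, ∅⟩, ⟨(hX t).union (hX t'), (hN t).union (hN t'),
      Set.finite_empty, Set.finite_empty⟩, (hO t ∅ ∅).mono ?_ ?_, (hO t' ∅ ∅).mono ?_ ?_⟩
    all_goals simp
  | pred P ts =>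
    refine ⟨⟨⋃ k, X (ts k), ⋃ k, N (ts k), ∅, {P}⟩, ⟨Set.finite_iUnion fun k => hX _,
      Set.finite_iUnion fun k => hN _, Set.finite_empty, Set.finite_singleton P⟩, rfl,
      fun k => (hO (ts k) ∅ ∅).mono ?_ ?_⟩
    · exact Set.subset_iUnion (fun k => X (ts k)) k
    · exact Set.subset_iUnion (fun k => N (ts k)) k
  | neg φ ih => exact ih
  | and φ ψ ih1 ih2 =>
    obtain ⟨V, hV, h⟩ := ih1
    obtain ⟨V', hV', h'⟩ := ih2
    exact ⟨max V V', hV.sup hV', h.mono (V.le_max_left V'), h'.mono (V.le_max_right V')⟩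
  | know i φ ih =>
    obtain ⟨V, hV, h⟩ := ih
    refine ⟨max V ⟨∅, ∅, {i}, ∅⟩, hV.sup ?_, Or.inr rfl, h.mono (V.le_max_left _)⟩
    simp [Vocabulary.Finite]
  | assign x t φ ih =>
    obtain ⟨V, hV, h⟩ := ih
    let V' : Vocabulary S := ⟨insert x (X t), N t, ∅, ∅⟩
    have hV' : V'.Finite := ⟨(hX t).insert x, hN t, Set.finite_empty, Set.finite_empty⟩
    refine ⟨max V V', hV.sup hV', Or.inr (Or.inl rfl), (hO t ∅ ∅).mono ?_ ?_,
      h.mono (V.le_max_left _)⟩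
    · exact fun y hy => Or.inr (Or.inr hy)
    · exact fun y hy => Or.inr hy

end DELAS

namespace DELAS

variable {S : Signature.{u}} [Infinite S.Var] {Ax : Formula S → Prop} [Basic Ax]

/-! ### Separating free from bound variables -/

theorem SFormula.finite_bv (φ : SFormula S) : φ.bv.Finite := by
  induction φ <;> simp_all [SFormula.bv]

theorem SFormula.finite_fv (φ : SFormula S) : φ.fv.Finite :=
  φ.toF.finite_vars.subset φ.toF.fv_subset_vars

variable (Ax) in
/-- For questions of validity and provability the free variables of a formula may be assumed not to
occur bound. -/
theorem SFormula.exists_disjoint (φ : SFormula S) : ∃ ψ : SFormula S, Disjoint ψ.fv ψ.bv ∧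
    (Derivable Ax ψ.toF → Derivable Ax φ.toF) ∧
    ∀ M : Model S, (∀ w σ, Sat φ.toF M w σ) → ∀ w σ, Sat ψ.toF M w σ := by
  induction hn : (φ.fv ∩ φ.bv).ncard generalizing φ with
  | zero =>
    rw [Set.ncard_eq_zero (φ.finite_fv.inter_of_left _)] at hn
    exact ⟨φ, Set.disjoint_iff_inter_eq_empty.2 hn, id, fun M h => h⟩
  | succ n ih =>
    obtain ⟨x, hx⟩ := Set.nonempty_of_ncard_ne_zero (hn.trans_ne n.succ_ne_zero)
    obtain ⟨y, hy⟩ := (φ.finite_fv.union φ.finite_bv).exists_notMem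
    -- Prefixing `[x := y]` with a fresh `y` trades the free `x` for a free `y` that is not bound,
    -- so the overlap loses `x`.
    obtain ⟨ψ, h1, h2, h3⟩ := ih (.assign x (.var y) φ) (by
      have : (SFormula.assign x (.var y) φ).fv ∩ (SFormula.assign x (.var y) φ).bv =
          (φ.fv ∩ φ.bv) \ {x} := by
        ext z
        simp only [SFormula.fv, SFormula.toF, Formula.fv, SFormula.bv, Term.vars, Set.mem_inter_iff,
          Set.mem_union, Set.mem_sdiff, Set.mem_singleton_iff, Set.mem_insert_iff]
        constructor
        · rintro ⟨h | rfl, rfl | h'⟩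
          · exact absurd rfl h.2
          · exact ⟨⟨h.1, h'⟩, h.2⟩
          · exact absurd (Or.inl hx.1) hy
          · exact absurd (Or.inr h') hy
        · exact fun h => ⟨Or.inl ⟨h.1.1, h.2⟩, Or.inr h.1.2⟩
      rw [this, Set.ncard_sdiff_singleton_of_mem hx, hn]
      rfl)
    exact ⟨ψ, h1, fun h => .of_assign (fun e => hy (Or.inl e)) (h2 h),
      fun M h => h3 M fun w σ => h w _⟩

/-! ### Completeness over arbitrary models -/

/-- A maximal consistent set with a finite set `U` of available parameters, where the denotations
`den` of the parameters agree with the equations. -/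
structure Stage (Ax : Formula S → Prop) (B : Set S.Var) {D : Type u} (den : S.Var → D)
    (U : Set S.Var) (Δ : Set (SFormula S)) : Prop where
  maxCons : MaxCons Ax Δ
  finite : U.Finite
  nonempty : U.Nonempty
  disjoint : ∀ x ∈ U, x ∉ B
  eq_iff : ∀ x ∈ U, ∀ y ∈ U, .eq (.var x) (.var y) ∈ Δ ↔ den x = den y

namespace Stage

open SFormula

variable {B U U₀ : Set S.Var} {D : Type u} {den : S.Var → D} {Δ : Set (SFormula S)}

/-- A name equal to no parameter is named by a fresh `y`, which `of_eq_imp` shows to be consistent.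
The new theory then separates `y` from all old parameters, in agreement with `den`, which gives
every variable outside `U₀` an object of its own. -/
theorem exists_witness_name (h : Stage Ax B den U Δ) (hB : B.Finite) (hU : U₀ ⊆ U)
    (hden : ∀ x, ∀ y ∉ U₀, den x = den y → x = y) (a : S.Name) :
    ∃ U' Θ, U ⊆ U' ∧ Stage Ax B den U' Θ ∧ (∀ φ ∈ Δ, φ.fv ⊆ U → φ ∈ Θ) ∧
      ∃ y ∈ U', eq (.name a) (.var y) ∈ Θ := by
  by_cases hw : ∃ y ∈ U, eq (.name a) (.var y) ∈ Δ
  · exact ⟨U, Δ, subset_rfl, h, fun φ hφ _ => hφ, hw⟩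
  push Not at hw
  -- `bot` contains a concrete variable, which `y` has to avoid as well.
  obtain ⟨y, hy⟩ := ((h.finite.union hB).union (bot : SFormula S).finite_fv).exists_notMem
  simp only [Set.mem_union, not_or] at hy
  obtain ⟨⟨hyU, hyB⟩, hyb⟩ := hy
  -- Only formulas with free variables in `U` are kept, for `Δ` may already have views on `y`.
  have hcons : ¬ Entails Ax (insert (eq (.name a) (.var y)) {φ | φ ∈ Δ ∧ φ.fv ⊆ U}) bot := by
    intro hb
    obtain ⟨u, hu⟩ := h.nonempty
    obtain ⟨c, hc, h1⟩ := Entails.exists_imp (Γ := {φ | φ ∈ Δ ∧ φ.fv ⊆ U})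
      ⟨eq (.var u) (.var u), h.maxCons.eq_refl _, by simpa [SFormula.fv, toF, Formula.fv, Term.vars]⟩
      (fun a ha b hb => ⟨h.maxCons.and_mem.2 ⟨ha.1, hb.1⟩, Set.union_subset ha.2 hb.2⟩)
      hb.deduction
    have h2 : Derivable Ax ((eq (.name a) (.var y)).toF.iff (eq (.var y) (.name a)).toF) :=
      .basic (.sym _ _)
    have h3 : Derivable Ax (c.imp bot).toF := by
      refine .of_eq_imp (y := y) (t := .name a) ?_ (.taut2 h1 h2 fun v hv => ?_)
      · rintro (hyc | hyc)
        · exact hyU (hc.2 hyc)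
        · exact hyb hyc
      · simp only [hv.toF_imp, hv.imp, hv.iff, toF]; tauto
    exact h.maxCons.bot_notMem (h.maxCons.mp h3 hc.1)
  obtain ⟨Θ, hΘ, hm⟩ := exists_maxCons hcons
  have hay : eq (.name a) (.var y) ∈ Θ := hΘ (Or.inl rfl)
  have hsub : ∀ φ ∈ Δ, φ.fv ⊆ U → φ ∈ Θ := fun φ h1 h2 => hΘ (Or.inr ⟨h1, h2⟩)
  have hne : ∀ x ∈ U, eq (.var x) (.var y) ∉ Θ := by
    intro x hx hxy
    have : neg (eq (.name a) (.var x)) ∈ Θ :=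
      hsub _ (h.maxCons.neg_mem.2 (hw x hx))
        (by simpa [SFormula.fv, toF, Formula.fv, Term.vars])
    exact hm.neg_mem.1 this (hm.eq_trans hay (hm.eq_comm.1 hxy))
  have hdne : ∀ x ∈ U, den x ≠ den y := fun x hx e =>
    hyU (hden x y (fun hy => hyU (hU hy)) e ▸ hx)
  refine ⟨insert y U, Θ, Set.subset_insert _ _, ⟨hm, h.finite.insert y, Set.insert_nonempty _ _,
    ?_, ?_⟩, hsub, y, Set.mem_insert _ _, hay⟩
  · rintro _ (rfl | hx)
    · exact hyB
    · exact h.disjoint _ hx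
  · intro x hx z hz
    rcases hx with rfl | hx <;> rcases hz with rfl | hz
    · simp [hm.eq_refl]
    · rw [hm.eq_comm]
      simp [hne z hz, (hdne z hz).symm]
    · simp [hne x hx, hdne x hx]
    · rw [← h.eq_iff x hx z hz]
      have hf : (eq (.var x) (.var z) : SFormula S).fv ⊆ U := by
        simp [SFormula.fv, toF, Formula.fv, Term.vars, Set.insert_subset_iff, hx, hz]
      refine ⟨fun h1 => ?_, fun h1 => hsub _ h1 hf⟩
      by_contra h2
      exact hm.neg_mem.1 (hsub _ (h.maxCons.neg_mem.2 h2) hf) h1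

theorem exists_witness (h : Stage Ax B den U Δ) (hB : B.Finite) (hU : U₀ ⊆ U)
    (hden : ∀ x, ∀ y ∉ U₀, den x = den y → x = y) {N : Set S.Name} (hN : N.Finite) :
    ∃ U' Θ, U ⊆ U' ∧ Stage Ax B den U' Θ ∧ (∀ φ ∈ Δ, φ.fv ⊆ U → φ ∈ Θ) ∧
      ∀ a ∈ N, ∃ y ∈ U', eq (.name a) (.var y) ∈ Θ := by
  induction N, hN using Set.Finite.induction_on with
  | empty => exact ⟨U, Δ, subset_rfl, h, fun φ hφ _ => hφ, by simp⟩
  | @insert a N _ _ ih =>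
    obtain ⟨U', Θ, h1, h2, h3, h4⟩ := ih
    obtain ⟨U'', Θ', h5, h6, h7, h8⟩ := h2.exists_witness_name hB (hU.trans h1) hden a
    refine ⟨U'', Θ', h1.trans h5, h6, fun φ hφ hf => h7 φ (h3 φ hφ hf) (hf.trans h1), ?_⟩
    rintro b (rfl | hb)
    · exact h8
    · obtain ⟨y, hy, h9⟩ := h4 b hb
      exact ⟨y, h5 hy, h7 _ h9 (by simpa [SFormula.fv, toF, Formula.fv, Term.vars])⟩

/-- By the rigidity axioms a successor theory contains the same equations between variables, so it
is a stage for the same `den`; missing witnesses for names are added afterwards. -/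
theorem exists_rel (h : Stage Ax B den U Δ) (hB : B.Finite) (hU : U₀ ⊆ U)
    (hden : ∀ x, ∀ y ∉ U₀, den x = den y → x = y) {N : Set S.Name} (hN : N.Finite)
    {i : S.Agent} {φ : SFormula S} (hφ : know i φ ∉ Δ) (hfv : φ.fv ⊆ U) :
    ∃ U' Θ, U ⊆ U' ∧ Stage Ax B den U' Θ ∧ (∀ ψ, know i ψ ∈ Δ → ψ.fv ⊆ U → ψ ∈ Θ) ∧
      (∀ a ∈ N, ∃ y ∈ U', eq (.name a) (.var y) ∈ Θ) ∧ φ ∉ Θ := by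
  obtain ⟨Θ, h1, h2, h3⟩ := h.maxCons.exists_of_know_notMem hφ
  have hs : Stage Ax B den U Θ := by
    refine ⟨h1, h.finite, h.nonempty, h.disjoint, fun x hx y hy => ?_⟩
    rw [← h.eq_iff x hx y hy]
    refine ⟨fun h4 => ?_, fun h4 => h2 _ (h.maxCons.know_eq h4)⟩
    by_contra h5
    exact h1.neg_mem.1 (h2 _ (h.maxCons.know_ne h5)) h4
  obtain ⟨U', Θ', h4, h5, h6, h7⟩ := hs.exists_witness hB hU hden hN
  exact ⟨U', Θ', h4, h5, fun ψ hψ hf => h6 _ (h2 _ hψ) hf, h7,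
    h5.maxCons.neg_mem.1 (h6 _ (h1.neg_mem.2 h3) hfv)⟩

end Stage

/-- The setoid of provably equal variables. -/
def MaxCons.setoid {Δ : Set (SFormula S)} (h : MaxCons Ax Δ) : Setoid S.Var where
  r x y := .eq (.var x) (.var y) ∈ Δ
  iseqv := ⟨fun _ => h.eq_refl _, h.eq_comm.1, h.eq_trans⟩

theorem Entails.derivable {Γ : Set (SFormula S)} (hΓ : ∀ b ∈ Γ, Derivable Ax b.toF)
    {a : SFormula S} (h : Entails Ax Γ a) : Derivable Ax a.toF := by
  induction h with
  | mem h => exact hΓ _ h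
  | thm h => exact h
  | mp _ _ ih1 ih2 => exact .mp' ih1 ih2

theorem exists_maxCons_of_not_derivable {φ : SFormula S} (h : ¬ Derivable Ax φ.toF) :
    ∃ Δ, MaxCons Ax Δ ∧ φ ∉ Δ := by
  have hc : ¬ Entails Ax (insert (SFormula.neg φ) ∅) SFormula.bot := by
    intro hb
    refine h (.taut1 (hb.deduction.derivable (by simp)) fun v hv => ?_)
    have := hv.bot
    simp only [SFormula.toF, hv.neg, hv.toF_imp]; tauto
  obtain ⟨Δ, h1, h2⟩ := exists_maxCons hc
  exact ⟨Δ, h2, h2.neg_mem.1 (h1 (Or.inl rfl))⟩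

open Classical in
/-- Completeness of the basic system for static formulas. -/
theorem static_complete {φ : SFormula S}
    (h : ∀ (M : Model S) (w : M.World) (σ : S.Var → M.Dom), Sat φ.toF M w σ) :
    Derivable Ax φ.toF := by
  obtain ⟨ψ, hdisj, hder, hsat⟩ := φ.exists_disjoint Ax
  refine hder ?_
  by_contra hψ
  obtain ⟨Δ, hΔ, hψΔ⟩ := exists_maxCons_of_not_derivable hψ
  obtain ⟨V₀, hV₀, hO⟩ := ψ.exists_over
  obtain ⟨v₀, hv₀⟩ := ψ.finite_bv.exists_notMem
  -- The variable `v₀` keeps the parameter set non-empty even if `ψ` has no free variables.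
  let U₀ : Set S.Var := insert v₀ ψ.fv
  -- The initial parameters are identified as `Δ` prescribes. Every other variable owns an object,
  -- ready for use as a fresh parameter at any world.
  let D : Type u := Quotient hΔ.setoid ⊕ S.Var
  let den : S.Var → D := fun x => if x ∈ U₀ then .inl (Quotient.mk _ x) else .inr x
  have hden : ∀ x, ∀ y ∉ U₀, den x = den y → x = y := by
    intro x y hy h
    by_cases hx : x ∈ U₀ <;> simp only [den, hx, hy, if_true, if_false] at h
    · exact absurd h Sum.inl_ne_inr
    · exact Sum.inr_injective h
  have hs₀ : Stage Ax ψ.bv den U₀ Δ := by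
    refine ⟨hΔ, ψ.finite_fv.insert _, Set.insert_nonempty _ _, ?_, fun x hx y hy => ?_⟩
    · rintro _ (rfl | hx)
      · exact hv₀
      · exact Set.disjoint_left.1 hdisj hx
    · simp only [den, hx, hy, if_true]
      exact (Quotient.eq (r := hΔ.setoid)).symm.trans Sum.inl_injective.eq_iff.symm
  let V : Vocabulary S := ⟨Set.univ, V₀.names, Set.univ, Set.univ⟩
  let C : Canonical S Ax V ψ.bv :=
    { World := {p : Set S.Var × Set (SFormula S) // U₀ ⊆ p.1 ∧ Stage Ax ψ.bv den p.1 p.2 ∧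
        ∀ a ∈ V₀.names, ∃ y ∈ p.1, .eq (.name a) (.var y) ∈ p.2}
      Dom := D
      rel := fun i p q => p.1.1 ⊆ q.1.1 ∧ ∀ χ, .know i χ ∈ p.1.2 → χ.fv ⊆ p.1.1 → χ ∈ q.1.2
      theory := fun p => p.1.2
      par := fun p => p.1.1
      den := den
      maxCons := fun p => p.2.2.1.maxCons
      par_over := fun _ _ _ => trivial
      par_notMem := fun p => p.2.2.1.disjoint
      eq_iff := fun p => p.2.2.1.eq_iff
      witness := fun p => p.2.2.2
      par_mono := fun h => h.1
      know := fun h h1 h2 => h.2 _ h2 h1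
      exists_rel := by
        intro i p χ _ _ hfv hχ
        obtain ⟨U', Θ, h1, h2, h3, h4, h5⟩ :=
          p.2.2.1.exists_rel ψ.finite_bv p.2.1 hden hV₀.2.1 hχ hfv
        exact ⟨⟨(U', Θ), p.2.1.trans h1, h2, h4⟩, ⟨h1, h3⟩, h5⟩ }
  obtain ⟨U, Θ, h1, h2, h3, h4⟩ := hs₀.exists_witness ψ.finite_bv subset_rfl hden hV₀.2.1
  let w : C.World := ⟨(U, Θ), h1, h2, h4⟩
  have hfv : ψ.fv ⊆ U₀ := Set.subset_insert _ _
  have hO' : ψ.Over V :=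
    hO.mono (V := V₀) (V' := V) ⟨Set.subset_univ _, subset_rfl, Set.subset_univ _, Set.subset_univ _⟩
  obtain ⟨σ, hσ⟩ := C.exists_sat_iff (w := w)
    hO' subset_rfl (hfv.trans h1) h2.nonempty
  exact h2.maxCons.neg_mem.1 (h3 _ (hΔ.neg_mem.2 hψΔ) hfv) (hσ.1 (hsat _ (h _) w σ))

end DELAS

namespace DELAS

variable {S : Signature.{u}} [Infinite S.Var] {Ax : Formula S → Prop} [Basic Ax]

open SFormula

/-! ### Countable vocabularies -/

/-- The depth of a static formula. -/
def SFormula.depth : SFormula S → ℕ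
  | eq _ _ => 0
  | pred _ _ => 0
  | neg φ => φ.depth + 1
  | and φ ψ => max φ.depth ψ.depth + 1
  | know _ φ => φ.depth + 1
  | assign _ _ φ => φ.depth + 1

theorem Term.countable_over {V : Vocabulary S} (hX : V.vars.Countable) (hN : V.names.Countable) :
    {t : Term S | t.Over V}.Countable := by
  refine ((hX.image Term.var).union (hN.image Term.name)).mono ?_
  rintro (x | a) h
  · exact Or.inl ⟨x, h, rfl⟩
  · exact Or.inr ⟨a, h, rfl⟩

/-- Countability lets a single ideal meet all requirements in `exists_rich`. -/
theorem SFormula.countable_over {V : Vocabulary S} (hX : V.vars.Countable) (hN : V.names.Countable)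
    (hA : V.agents.Countable) (hP : V.preds.Countable) : {φ : SFormula S | φ.Over V}.Countable := by
  have hT := Term.countable_over hX hN
  have key : ∀ n, {φ : SFormula S | φ.Over V ∧ φ.depth < n}.Countable := by
    intro n
    induction n with
    | zero => simp
    | succ n ih =>
      refine (((((hT.image2 hT eq).union
        (hP.biUnion fun P _ => (Set.countable_univ_pi fun _ : Fin (S.arity P) => hT).image
          (pred P))).union (ih.image neg)).union (ih.image2 ih and)).union
        ((hA.biUnion fun i _ => ih.image (know i)).union
        (hX.biUnion fun x _ => hT.image2 ih (assign x)))).mono ?_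
      rintro (⟨t, t'⟩ | ⟨P, ts⟩ | φ | ⟨φ, ψ⟩ | ⟨i, φ⟩ | ⟨x, t, φ⟩) ⟨h, hd⟩
      · exact Or.inl (Or.inl (Or.inl (Or.inl ⟨t, h.1, t', h.2, rfl⟩)))
      · exact Or.inl (Or.inl (Or.inl (Or.inr
          (Set.mem_biUnion h.1 ⟨ts, fun k _ => h.2 k, rfl⟩))))
      · exact Or.inl (Or.inl (Or.inr ⟨φ, ⟨h, Nat.lt_of_succ_lt_succ hd⟩, rfl⟩))
      · have hd := max_lt_iff.1 (Nat.lt_of_succ_lt_succ hd)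
        exact Or.inl (Or.inr ⟨φ, ⟨h.1, hd.1⟩, ψ, ⟨h.2, hd.2⟩, rfl⟩)
      · exact Or.inr (Or.inl
          (Set.mem_biUnion h.1 ⟨φ, ⟨h.2, Nat.lt_of_succ_lt_succ hd⟩, rfl⟩))
      · exact Or.inr (Or.inr
          (Set.mem_biUnion h.1 ⟨t, h.2.1, φ, ⟨h.2.2, Nat.lt_of_succ_lt_succ hd⟩, rfl⟩))
  refine (Set.countable_iUnion key).mono fun φ h => ?_
  exact Set.mem_iUnion.2 ⟨φ.depth + 1, h, Nat.lt_succ_self _⟩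

/-! ### Necessity forms -/

/-- Necessity forms: nested implications and epistemic operators around a hole. -/
abbrev NecForm (S : Signature.{u}) := List (SFormula S ⊕ S.Agent)

/-- The result of filling the hole of a necessity form. -/
def NecForm.plug : NecForm S → SFormula S → SFormula S
  | [], θ => θ
  | .inl ψ :: L, θ => ψ.imp (plug L θ)
  | .inr i :: L, θ => know i (plug L θ)

/-- The formula saying that `y` is not what the name `a` denotes. -/
noncomputable def neName (a : S.Name) (y : S.Var) : SFormula S :=
  (eq (.name a) (.var y)).imp bot

/-- The sets of axioms that contain the S5 axioms. -/
class Epistemic (Ax : Formula S → Prop) : Prop where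
  s5 : ∀ χ, S5Axiom χ → Ax χ

theorem Derivable.s5 [Epistemic Ax] {a : Formula S} (h : S5Axiom a) : Derivable Ax a :=
  .ax _ (Epistemic.s5 _ h)

/-- A fresh variable used as a witness for a name inside a necessity form can be eliminated. -/
theorem NecForm.derivable_plug [Epistemic Ax] {a : S.Name} {y : S.Var} (L : NecForm S) :
    ∀ χ : SFormula S, y ∉ χ.fv → y ∉ (L.plug bot).fv →
      Derivable Ax (χ.imp (L.plug (neName a y))).toF → Derivable Ax (χ.imp (L.plug bot)).toF := by
  induction L with
  | nil =>
    intro χ hχ hb h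
    have h2 : Derivable Ax ((eq (.name a) (.var y)).toF.iff (eq (.var y) (.name a)).toF) :=
      .basic (.sym _ _)
    refine .of_eq_imp (y := y) (t := .name a) (fun e => e.elim hχ hb)
      (.taut2 h h2 fun v hv => ?_)
    simp only [plug, neName, hv.toF_imp, hv.imp, hv.iff, toF]; tauto
  | cons s L ih =>
    rcases s with ψ | i
    · intro χ hχ hb h
      refine .taut1 (ih (.and χ ψ) (fun e => e.elim hχ fun e => hb (Or.inl e))
        (fun e => hb (Or.inr e)) (.taut1 h fun v hv => ?_)) fun v hv => ?_
      all_goals simp only [plug, hv.toF_imp, toF, hv.and]; tauto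
    · intro χ hχ hb h
      -- In S5, `χ → K ρ` is provable iff `¬ K ¬ χ → ρ` is. This moves the operator from the form to
      -- the antecedent, and back after the induction hypothesis.
      have h1 : Derivable Ax ((neg (know i (neg χ))).imp (plug L (neName a y))).toF := by
        set ρ := plug L (neName a y)
        have e1 : Derivable Ax ((know i (neg (know i ρ))).imp (know i (neg χ))).toF :=
          .know_imp i (.taut1 h fun v hv => by
            simp only [plug, hv.imp, hv.toF_imp, toF, hv.neg]; tauto)
        have e2 : Derivable Ax ((neg (know i ρ)).imp (know i (neg (know i ρ)))).toF :=
          .s5 (.five i ρ.toF)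
        have e3 : Derivable Ax ((know i ρ).imp ρ).toF := .s5 (.t i ρ.toF)
        exact .taut3 e1 e2 e3 fun v hv => by simp only [hv.toF_imp, toF, hv.neg]; tauto
      have h2 := ih (neg (know i (neg χ))) (fun e => hχ e) (fun e => hb e) h1
      have e1 : Derivable Ax
          ((know i (neg (know i (neg χ)))).imp (know i (plug L bot))).toF := .know_imp i h2
      have e2 : Derivable Ax
          ((neg (know i (neg χ))).imp (know i (neg (know i (neg χ))))).toF :=
        .s5 (.five i (neg χ).toF)
      have e3 : Derivable Ax ((know i (neg χ)).imp (neg χ)).toF := .s5 (.t i (neg χ).toF)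
      exact .taut3 e1 e2 e3 fun v hv => by simp only [plug, hv.toF_imp, toF, hv.neg]; tauto

/-- The necessity forms over a vocabulary. -/
abbrev NecFormOver (V : Vocabulary S) := List ({φ : SFormula S // φ.Over V} ⊕ V.agents)

/-- The underlying necessity form. -/
def NecFormOver.form {V : Vocabulary S} (L : NecFormOver V) : NecForm S :=
  L.map (Sum.map Subtype.val Subtype.val)

theorem SFormula.Over.imp {V : Vocabulary S} {φ ψ : SFormula S} (h1 : φ.Over V) (h2 : ψ.Over V) :
    (φ.imp ψ).Over V :=
  ⟨h1, h2⟩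

theorem NecFormOver.over_plug {V : Vocabulary S} {θ : SFormula S} (hθ : θ.Over V) :
    ∀ L : NecFormOver V, (L.form.plug θ).Over V
  | [] => hθ
  | .inl ψ :: L => SFormula.Over.imp ψ.2 (over_plug hθ L)
  | .inr i :: L => ⟨i.2, over_plug hθ L⟩

/-! ### Rich sets -/

/-- Rich sets have witnesses from `Y` for the names in all necessity forms. -/
def Rich (V : Vocabulary S) (Y : Set S.Var) (Δ : Set (SFormula S)) : Prop :=
  ∀ (L : NecFormOver V), ∀ a ∈ V.names, (∀ y ∈ Y, L.form.plug (neName a y) ∈ Δ) →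
    L.form.plug bot ∈ Δ

/-- A set is extendable if witnesses for names can consistently be added to it. -/
def Extendable (Ax : Formula S → Prop) (V : Vocabulary S) (Y : Set S.Var)
    (Γ : Set (SFormula S)) : Prop :=
  ∀ φ : SFormula S, φ.Over V → ∀ (L : NecFormOver V), ∀ a ∈ V.names,
    (∀ y ∈ Y, Entails Ax Γ (φ.imp (L.form.plug (neName a y)))) →
    Entails Ax Γ (φ.imp (L.form.plug bot))

/-- The formulas of a vocabulary that are consistent with `Γ`, ordered by strength. -/
structure Condition (Ax : Formula S → Prop) (V : Vocabulary S) (Γ : Set (SFormula S)) where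
  formula : SFormula S
  isOver : formula.Over V
  consistent : ¬ Entails Ax Γ (neg formula)

instance (V : Vocabulary S) (Γ : Set (SFormula S)) : Preorder (Condition Ax V Γ) where
  le p q := Derivable Ax (q.formula.imp p.formula).toF
  le_refl p := .taut fun v hv => hv.toF_imp.2 id
  le_trans p q r h1 h2 := .imp_trans h2 h1

/-- Lindenbaum's lemma for rich sets. -/
theorem exists_rich {V : Vocabulary S} {Y : Set S.Var} {Γ : Set (SFormula S)}
    (hX : V.vars.Countable) (hN : V.names.Countable) (hA : V.agents.Countable)
    (hP : V.preds.Countable) (hbot : (bot : SFormula S).Over V) (hY : Y ⊆ V.vars)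
    (hΓ : Extendable Ax V Y Γ) {φ : SFormula S} (hφ : φ.Over V) (hc : ¬ Entails Ax Γ (neg φ)) :
    ∃ Θ, MaxCons Ax Θ ∧ Γ ⊆ Θ ∧ φ ∈ Θ ∧ Rich V Y Θ := by
  have : Countable {φ : SFormula S // φ.Over V} := SFormula.countable_over hX hN hA hP
  have : Countable V.agents := hA
  have : Countable V.names := hN
  let _ : Encodable (NecFormOver V × V.names) := Encodable.ofCountable _
  -- For each form and name, the conditions that settle the requirement: they imply the form filled
  -- with `bot`, or refute its instance for some `y`.
  let Dn : NecFormOver V × V.names → Order.Cofinal (Condition Ax V Γ) := fun s =>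
    { carrier := {p | Derivable Ax (p.formula.imp (s.1.form.plug bot)).toF ∨
        ∃ y ∈ Y, Derivable Ax (p.formula.imp (neg (s.1.form.plug (neName s.2.1 y)))).toF}
      isCofinal := by
        rintro ⟨γ, hγ, hcons⟩
        obtain ⟨L, a, ha⟩ := s
        have hne : ∀ y ∈ Y, (neName a y).Over V := fun y hy =>
          SFormula.Over.imp ⟨ha, hY hy⟩ hbot
        by_cases h1 : Entails Ax Γ (neg (and γ (L.form.plug bot)))
        -- Here `γ` refutes the form filled with `bot`. If `γ` also implied every instance,
        -- extendability would make `γ` inconsistent with `Γ`.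
        · have h2 : ∃ y ∈ Y, ¬ Entails Ax Γ (neg (and γ (neg (L.form.plug (neName a y))))) := by
            by_contra! h2
            refine hcons (.taut2 h1 (hΓ γ hγ L a ha fun y hy => .taut1 (h2 y hy) fun v hv => ?_)
              fun v hv => ?_)
            all_goals simp only [hv.toF_imp, toF, hv.neg, hv.and]; tauto
          obtain ⟨y, hy, h2⟩ := h2
          refine ⟨⟨and γ (neg _), ⟨hγ, L.over_plug (hne y hy)⟩, h2⟩, Or.inr ⟨y, hy, .taut fun v hv => ?_⟩,
            .taut fun v hv => ?_⟩
          all_goals simp only [hv.toF_imp, toF, hv.neg, hv.and]; tauto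
        · refine ⟨⟨and γ _, ⟨hγ, L.over_plug hbot⟩, h1⟩, Or.inl (.taut fun v hv => ?_),
            .taut fun v hv => ?_⟩
          all_goals simp only [hv.toF_imp, toF, hv.and]; tauto }
  let p₀ : Condition Ax V Γ := ⟨φ, hφ, hc⟩
  let I := Order.idealOfCofinals p₀ Dn
  -- By directedness, a consequence of `Γ` and the whole ideal already follows from `Γ` and one
  -- condition, so consistency is preserved.
  have hI : ∀ b, Entails Ax (Γ ∪ Condition.formula '' (I : Set (Condition Ax V Γ))) b →
      ∃ p ∈ I, Entails Ax Γ (p.formula.imp b) := by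
    intro b hb
    induction hb with
    | mem h =>
      rcases h with h | ⟨p, hp, rfl⟩
      · exact ⟨p₀, Order.mem_idealOfCofinals _ _,
          .taut1 (.mem h) fun v hv h => hv.toF_imp.2 fun _ => h⟩
      · exact ⟨p, hp, .thm (.taut fun v hv => hv.toF_imp.2 id)⟩
    | thm h => exact ⟨p₀, Order.mem_idealOfCofinals _ _,
          .taut1 (.thm h) fun v hv h => hv.toF_imp.2 fun _ => h⟩
    | mp _ _ ih1 ih2 =>
      obtain ⟨p, hp, h1⟩ := ih1
      obtain ⟨q, hq, h2⟩ := ih2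
      obtain ⟨r, hr, hpr, hqr⟩ := I.directed p hp q hq
      refine ⟨r, hr, ?_⟩
      have h3 : Entails Ax Γ (r.formula.imp _) := .taut2 (.thm hpr) h1 fun v hv h1 h2 =>
        hv.toF_imp.2 fun h => hv.toF_imp.1 h2 (hv.toF_imp.1 h1 h)
      have h4 : Entails Ax Γ (r.formula.imp _) := .taut2 (.thm hqr) h2 fun v hv h1 h2 =>
        hv.toF_imp.2 fun h => hv.toF_imp.1 h2 (hv.toF_imp.1 h1 h)
      refine .taut2 h3 h4 fun v hv => ?_
      simp only [hv.toF_imp]; tauto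
  obtain ⟨Θ, hΘ, hm⟩ := exists_maxCons (Ax := Ax)
    (Γ := Γ ∪ Condition.formula '' (I : Set (Condition Ax V Γ))) (fun hb => by
      obtain ⟨p, -, h⟩ := hI _ hb
      refine p.consistent (.taut1 h fun v hv => ?_)
      have := hv.bot
      simp only [hv.toF_imp, toF, hv.neg]; tauto)
  have hIΘ : ∀ p ∈ I, p.formula ∈ Θ := fun p hp => hΘ (Or.inr ⟨p, hp, rfl⟩)
  refine ⟨Θ, hm, fun b hb => hΘ (Or.inl hb), hIΘ p₀ (Order.mem_idealOfCofinals _ _), ?_⟩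
  intro L a ha h
  obtain ⟨p, hp, hpI⟩ := Order.cofinal_meets_idealOfCofinals p₀ Dn (L, ⟨a, ha⟩)
  rcases hp with hp | ⟨y, hy, hp⟩
  · exact hm.mp hp (hIΘ p hpI)
  · exact absurd (h y hy) (hm.neg_mem.1 (hm.mp hp (hIΘ p hpI)))

/-- As `Y` is infinite, some `y` in it is fresh for the formula and the form, and
`NecForm.derivable_plug` eliminates it. -/
theorem extendable_empty [Epistemic Ax] {V : Vocabulary S} {Y : Set S.Var} (hY : Y.Infinite) :
    Extendable Ax V Y ∅ := by
  intro φ hφ L a ha h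
  obtain ⟨y, hy, hf⟩ := (hY.sdiff (φ.finite_fv.union (L.form.plug bot).finite_fv)).nonempty
  rw [Set.mem_union, not_or] at hf
  exact .thm (NecForm.derivable_plug L.form φ hf.1 hf.2 ((h y hy).derivable (by simp)))

/-- A necessity form behind `φ →` and `K i` is again a necessity form, so richness of `Δ` applies to
it directly. -/
theorem Rich.extendable {V : Vocabulary S} {Y : Set S.Var} {Δ : Set (SFormula S)}
    (hΔ : MaxCons Ax Δ) (h : Rich V Y Δ) {i : S.Agent} (hi : i ∈ V.agents) :
    Extendable Ax V Y {b | know i b ∈ Δ} := by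
  intro φ hφ L a ha hy
  exact .mem (h (.inr ⟨i, hi⟩ :: .inl ⟨φ, hφ⟩ :: L) a ha fun y hyY =>
    hΔ.know_of_entails (fun b hb => hb) (hy y hyY))

/-! ### Completeness over epistemic models -/

namespace MaxCons

variable [Epistemic Ax] {Δ Θ Λ : Set (SFormula S)} {i : S.Agent}

theorem mem_of_know (h : MaxCons Ax Δ) {a : SFormula S} (ha : know i a ∈ Δ) : a ∈ Δ :=
  h.mp (a := know i a) (.s5 (.t i a.toF)) ha

theorem know_know (h : MaxCons Ax Δ) {a : SFormula S} (ha : know i a ∈ Δ) :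
    know i (know i a) ∈ Δ :=
  h.mp (a := know i a) (.s5 (.four i a.toF)) ha

theorem know_not_know (h : MaxCons Ax Δ) {a : SFormula S} (ha : know i a ∉ Δ) :
    know i (neg (know i a)) ∈ Δ :=
  h.mp (a := neg (know i a)) (.s5 (.five i a.toF)) (h.neg_mem.2 ha)

end MaxCons

/-- Completeness of the epistemic system for static formulas. -/
theorem static_complete_epistemic [Epistemic Ax] {φ : SFormula S}
    (h : ∀ M : Model S, M.IsEpistemic → ∀ (w : M.World) (σ : S.Var → M.Dom), Sat φ.toF M w σ) :
    Derivable Ax φ.toF := by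
  obtain ⟨ψ, hdisj, hder, hsat⟩ := φ.exists_disjoint Ax
  refine hder ?_
  by_contra hψ
  obtain ⟨V₀, hV₀, hO⟩ := ψ.exists_over
  obtain ⟨Y₀, hY₀, hY₀c, hY₀i⟩ := ψ.finite_bv.infinite_compl.exists_subset_countable_infinite
  let Y : Set S.Var := Y₀ ∪ ψ.fv
  have hYi : Y.Infinite := hY₀i.mono Set.subset_union_left
  have hYB : ∀ x ∈ Y, x ∉ ψ.bv := by
    rintro x (hx | hx)
    · exact hY₀ hx
    · exact Set.disjoint_left.1 hdisj hx
  let V : Vocabulary S :=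
    -- The extra variable is the one occurring in `bot`.
    ⟨insert (Classical.arbitrary _) (Y ∪ V₀.vars), V₀.names, V₀.agents, V₀.preds⟩
  have hX : V.vars.Countable :=
    ((hY₀c.union ψ.finite_fv.countable).union hV₀.1.countable).insert _
  have hN : V.names.Countable := hV₀.2.1.countable
  have hA : V.agents.Countable := hV₀.2.2.1.countable
  have hP : V.preds.Countable := hV₀.2.2.2.countable
  have hbot : (bot : SFormula S).Over V := by simp [bot, SFormula.Over, Term.Over, V]
  have hY : Y ⊆ V.vars := fun x hx => Or.inr (Or.inl hx)
  have hO' : ψ.Over V := hO.mono (V := V₀) (V' := V)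
    ⟨fun x hx => Or.inr (Or.inr hx), subset_rfl, subset_rfl, subset_rfl⟩
  obtain ⟨Δ, hΔ, -, hψΔ, hr⟩ := exists_rich (φ := neg ψ) hX hN hA hP hbot hY
    (extendable_empty (Ax := Ax) hYi) hO'
    (fun hb => hψ (.taut1 (hb.derivable (by simp)) fun v hv => by
      simp only [toF, hv.neg]; tauto))
  let C : Canonical S Ax V ψ.bv :=
    { World := {Θ : Set (SFormula S) // MaxCons Ax Θ ∧ Rich V Y Θ ∧
        -- Agreement on equations lets all worlds share one quotient as domain; rigidity passes it
        -- on to successors.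
        ∀ x y, eq (.var x) (.var y) ∈ Θ ↔ eq (.var x) (.var y) ∈ Δ}
      Dom := Quotient hΔ.setoid
      rel := fun i p q => ∀ χ, know i χ ∈ p.1 → χ ∈ q.1
      theory := fun p => p.1
      par := fun _ => Y
      den := Quotient.mk _
      maxCons := fun p => p.2.1
      par_over := fun _ => hY
      par_notMem := fun _ => hYB
      eq_iff := fun p x _ y _ => (p.2.2.2 x y).trans (Quotient.eq (r := hΔ.setoid)).symm
      witness := by
        intro p a ha
        by_contra! hw
        -- Richness for the empty form: without a witness, the theory would contain `bot`.
        refine p.2.1.bot_notMem (p.2.2.1 [] a ha fun y hy => ?_)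
        exact p.2.1.imp_mem.2 fun h => absurd h (hw y hy)
      par_mono := fun _ => subset_rfl
      know := fun h _ h2 => h _ h2
      exists_rel := by
        intro i p χ hi hχ hfv hn
        obtain ⟨Θ, h1, h2, h3, h4⟩ := exists_rich (φ := neg χ) hX hN hA hP hbot hY
          (p.2.2.1.extendable p.2.1 hi) hχ
          (fun hb => hn (p.2.1.know_of_entails (fun b hb => hb) (.taut1 hb fun v hv => by
            simp only [toF, hv.neg]; tauto)))
        refine ⟨⟨Θ, h1, h4, fun x y => ?_⟩, fun b hb => h2 hb, h1.neg_mem.1 h3⟩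
        rw [← p.2.2.2 x y]
        refine ⟨fun h5 => ?_, fun h5 => h2 (p.2.1.know_eq h5)⟩
        by_contra h6
        exact h1.neg_mem.1 (h2 (p.2.1.know_ne h6)) h5 }
  have hC : C.model.IsEpistemic := fun i =>
    ⟨fun p χ hχ => p.2.1.mem_of_know hχ, fun {p q} hpq χ hχ => by
      by_contra hn
      have hk : know i χ ∉ p.1 := fun hk => hn (p.2.1.mem_of_know hk)
      exact q.2.1.neg_mem.1 (hpq _ (p.2.1.know_not_know hk)) hχ,
    fun {p q r} hpq hqr χ hχ => hqr _ (hpq _ (p.2.1.know_know hχ))⟩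
  let w : C.World := ⟨Δ, hΔ, hr, fun _ _ => Iff.rfl⟩
  obtain ⟨σ, hσ⟩ := C.exists_sat_iff (w := w) hO' subset_rfl Set.subset_union_right hYi.nonempty
  exact hΔ.neg_mem.1 hψΔ (hσ.1 (hsat _ (h _ hC) w σ))

end DELAS

/-! ### Completeness of the two dynamic systems -/

namespace DELAS

variable {S : Signature.{u}} [Infinite S.Var]

instance : Basic (fun χ : Formula S => BasicAxiom χ ∨ ReductionAxiom χ) := ⟨fun _ => Or.inl⟩

instance : Basic (fun χ : Formula S => BasicAxiom χ ∨ S5Axiom χ ∨ ReductionAxiom χ) :=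
  ⟨fun _ => Or.inl⟩

instance : Epistemic (fun χ : Formula S => BasicAxiom χ ∨ S5Axiom χ ∨ ReductionAxiom χ) :=
  ⟨fun _ h => Or.inr (Or.inl h)⟩

theorem sdelas_complete {φ : Formula S} (h : Valid φ) : SDELAS φ := by
  obtain ⟨ψ, h1, h2⟩ := (reducible_aux
    (Ax := fun χ : Formula S => BasicAxiom χ ∨ ReductionAxiom χ) (fun _ => Or.inr) φ).1
  exact .mp' h1.iff_right (static_complete fun M w σ => (h2 M w σ).1 (h M w σ))

theorem sdelas5_complete {φ : Formula S} (h : EpistemicValid φ) : SDELAS5 φ := by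
  obtain ⟨ψ, h1, h2⟩ := (reducible_aux
    (Ax := fun χ : Formula S => BasicAxiom χ ∨ S5Axiom χ ∨ ReductionAxiom χ)
    (fun _ h => Or.inr (Or.inr h)) φ).1
  exact .mp' h1.iff_right (static_complete_epistemic fun M hM w σ => (h2 M w σ).1 (h M hM w σ))

end DELAS

theorem mainTheorem3 (S : DELAS.Signature.{u}) [Infinite S.Var] :
    (∀ φ : DELAS.Formula S, DELAS.Valid φ → DELAS.SDELAS φ) ∧
    (∀ φ : DELAS.Formula S, DELAS.EpistemicValid φ → DELAS.SDELAS5 φ) :=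
  ⟨fun _ => DELAS.sdelas_complete, fun _ => DELAS.sdelas5_complete⟩
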